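/- Let $k=2s+1$ be a positive odd integer, let $a_1,a_2,a_3\in\mathbb C$ be pairwise distinct (real for a rigid body), and let $l,m\in\mathbb C$, $m\neq0$, $c=l/m^2\notin\{a_1,a_2,a_3\}$. Put $a=\mathrm{diag}(a_1,a_2,a_3)$ and consider the Euler and the generalized Poisson equations $$\dot M=M\times aM,\qquad \dot\gamma=k\,\gamma\times aM,\qquad \langle M,aM\rangle=l,\quad \langle M,M\rangle=m^2 .$$ Let $a_{ij}=a_i-a_j$, $b_i=ka_i$, $$A_n=\begin{pmatrix}-n a_{32}&b_3&-b_2\\-b_3&-n a_{13}&b_1\\b_2&-b_1&-n a_{21}\end{pmatrix},\qquad K=\mathrm{diag}(M_1^2,M_2^2,M_3^2),$$ let $T$ span $\ker A_k$, and let $$P(M)=\mathrm{diag}(M_1,M_2,M_3)\,(A_1^{-1}K)(A_3^{-1}K)\cdots(A_{k-2}^{-1}K)\,T.$$ Substituting $M_\alpha^2=m^2\frac{(a_\beta-c)(a_\gamma-c)}{(a_\alpha-a_\beta)(a_\alpha-a_\gamma)}\,\frac{\lambda-a_\alpha}{\lambda-c}$ (with $\{\alpha,\beta,\gamma\}=\{1,2,3\}$)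 one gets $P(M)_\alpha=m^{2s}M_\alpha F_{s,\alpha}(\lambda)/(\lambda-c)^s$, where $F_{s,\alpha}$ is a polynomial of degree at most $s$; let $\rho_{1,\alpha},\dots,\rho_{s,\alpha}\in\mathbb C\cup\{\infty\}$ be its roots with multiplicity (missing roots are put at $\infty$). Let $U_4(\lambda)=-(\lambda-a_1)(\lambda-a_2)(\lambda-a_3)(\lambda-c)$, let $\tau_1,\tau_2$ be the first two elementary symmetric functions of the $a_i$, let $$3e_\alpha=\tau_2+c\,\tau_1-3(a_\beta a_\gamma+c\,a_\alpha),$$ and let $\wp,\zeta,\sigma$ be the Weierstrass functions of the lattice $\Lambda$ with the invariants $g_2,g_3$ of the curve $w^2=4(z-e_1)(z-e_2)(z-e_3)=4z^3-g_2z-g_3$. Let $$\Omega_\alpha=i\int_c^{a_\alpha}\frac{d\lambda}{2\sqrt{U_4(\lambda)}},\qquad v_{r,\alpha}=i\int_c^{\rho_{r,\alpha}}\frac{d\lambda}{2\sqrt{U_4(\lambda)}}$$ (along any paths, with any choice of the branches), where the $\Omega_\alpha$ are chosen such that $\Omega_1+\Omega_2+\Omega_3=0$ and $\Lambda=2\Omega_1\mathbb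 Z+2\Omega_3\mathbb Z$. Let $\sigma_\alpha(u)=e^{\zeta(\Omega_\alpha)u}\,\sigma(\Omega_\alpha-u)/\sigma(\Omega_\alpha)$. Let $\epsilon_1,\epsilon_2,\epsilon_3\in\mathbb C$ satisfy $$\epsilon_\alpha^2=\frac1{(a_\alpha-a_\beta)(a_\alpha-a_\gamma)},\qquad \frac1{\epsilon_1\epsilon_2\epsilon_3}=i\,(a_1-a_2)(a_2-a_3)(a_3-a_1),$$ and put $$M_\alpha(u)=m\,\epsilon_\alpha\frac{\sigma_\alpha(u)}{\sigma(u)},\qquad P_\alpha(u)=\epsilon_\alpha\frac{\sigma_\alpha(u)}{\sigma(u)}\prod_{r=1}^s\frac{\sigma(u+v_{r,\alpha})\,\sigma(u-v_{r,\alpha})}{\sigma^2(v_{r,\alpha})\,\sigma^2(u)} .$$ Then no $v_{r,\alpha}$ lies in $\Lambda$, and there is a constant $\kappa\ne0$, independent of the choice of the $\epsilon_\alpha$, of the solution and of time, such that: 1. For every $t_0\in\mathbb C$, with $u=im(t-t_0)+\Omega_2$, the vectors $M(u)$ and $\gamma=P(u)$ satisfy the Euler and the Poisson equations at every $t\in\mathbb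 C$ with $u\notin\Lambda$. 2. For every holomorphic solution $M(t)$ of the Euler equations on a connected open set in $\mathbb C$ with $\langle M,aM\rangle=l$, $\langle M,M\rangle=m^2$ there is $t_0\in\mathbb C$ such that, with $u=im(t-t_0)+\Omega_2$, one has on that set $u\notin\Lambda$, $M(t)=M(u)$ and $P(M(t))=\kappa\,P(u)$. If $a_1<a_2<a_3$ and $m$ are real, then for every real solution $M(t)$, $t\in\mathbb R$, with these values of the integrals the same holds on $\mathbb R$ with a real $t_0$, for a suitable choice of the $\epsilon_\alpha$ as above. 3. For all $u\in\mathbb C\setminus\Lambda$, $$P_\alpha^2(u)=\epsilon_\alpha^2\,(\wp(u)-\wp(\Omega_\alpha))\prod_{l=1}^s(\wp(u)-\wp(v_{l,\alpha}))^2,\qquad \alpha=1,2,3.$$ 4. For all $u\in\mathbb C\setminus\Lambda$, $M_1^2(u)+M_2^2(u)+M_3^2(u)=m^2$ and $P_1^2(u)+P_2^2(u)+P_3^2(u)=\Pi$, where for every permutation $(\alpha,\beta,\gamma)$ of $(1,2,3)$ $$\Pi=\epsilon_\beta^2(\wp(\Omega_\alpha)-\wp(\Omega_\beta))\prod_{l=1}^s(\wp(\Omega_\alpha)-\wp(v_{l,\beta}))^2+\epsilon_\gamma^2(\wp(\Omega_\alpha)-\wp(\Omega_\gamma))\prod_{l=1}^s(\wp(\Omega_\alpha)-\wp(v_{l,\gamma}))^2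 .$$ -/

import Mathlib

open Polynomial Matrix Set Filter Topology

noncomputable section

namespace EulerPoisson

/-- The matrix `A_n`, for the vector `b = k a`. -/
def matA (a : Fin 3 → ℂ) (k n : ℕ) : Matrix (Fin 3) (Fin 3) ℂ :=
  !![-n * (a 2 - a 1), k * a 2, -(k * a 1);
     -(k * a 2), -n * (a 0 - a 2), k * a 0;
     k * a 1, -(k * a 0), -n * (a 1 - a 0)]

/-- `Φ_k(M) = (A_1⁻¹ K) (A_3⁻¹ K) ⋯ (A_{k-2}⁻¹ K)` with `K = diag (M₁², M₂², M₃²)`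
and `k = 2 s + 1`. -/
def matPhi (a : Fin 3 → ℂ) (s : ℕ) (M : Fin 3 → ℂ) : Matrix (Fin 3) (Fin 3) ℂ :=
  ((List.range s).map fun j =>
    (matA a (2 * s + 1) (2 * j + 1))⁻¹ * diagonal fun i => M i ^ 2).prod

/-- The vector `P(M) = diag (M₁, M₂, M₃) Φ_k(M) T`, with `k = 2 s + 1`. -/
def vecP (a : Fin 3 → ℂ) (s : ℕ) (T M : Fin 3 → ℂ) : Fin 3 → ℂ :=
  diagonal M *ᵥ (matPhi a s M *ᵥ T)

/-- The quartic `U₄(x) = -(x - a₁)(x - a₂)(x - a₃)(x - c)`. -/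
def U4 (a : Fin 3 → ℂ) (c x : ℂ) : ℂ :=
  -((x - a 0) * (x - a 1) * (x - a 2) * (x - c))

/-- The numerator `F_{s,α}(X)` of the `α`-th component of `Φ_k(M) T` after the substitution
`M_α² = κ_α (X - a_α) / (X - c)`, where
`κ_α = (a_β - c)(a_γ - c) / ((a_α - a_β)(a_α - a_γ))`: the matrix `K` becomes
`(X - c)⁻¹ diag (κ_α (X - a_α))`, and `(X - c)^(-s)` is taken out.
(The constant factor `m ^ 2` of each `M_α²` is left out.) -/
def polyF (a : Fin 3 → ℂ) (c : ℂ) (s : ℕ) (T : Fin 3 → ℂ) (α : Fin 3) : ℂ[X] :=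
  (((List.range s).map fun j =>
    ((matA a (2 * s + 1) (2 * j + 1))⁻¹).map (C : ℂ → ℂ[X]) *
      diagonal fun i : Fin 3 =>
        C ((a (i + 1) - c) * (a (i + 2) - c) / ((a i - a (i + 1)) * (a i - a (i + 2)))) *
          (X - C (a i))).prod *ᵥ fun i => C (T i)) α

/-- The `s` roots, with multiplicity, on the Riemann sphere of a polynomial of formal degree
`s`: if its actual degree is smaller, the missing roots are at infinity. -/
def sphereRoots (p : ℂ[X]) (s : ℕ) : Multiset (OnePoint ℂ) :=
  p.roots.map (fun x => (x : OnePoint ℂ)) + Multiset.replicate (s - p.natDegree) OnePoint.infty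

/-- `u` is a value of the Abel integral `i ∫_c^p dx / (2 √(U₄ x))`: the integral is taken along
a path `x` from the branch point `c` to the point `p` of the Riemann sphere, with a continuous
choice `y` of the square root of `U₄` along it; in its interior the path stays away from the
branch points and from infinity. -/
def IsAbelIntegral (a : Fin 3 → ℂ) (c : ℂ) (p : OnePoint ℂ) (u : ℂ) : Prop :=
  ∃ x x' y : ℝ → ℂ,
    (∀ t ∈ Ioo (0 : ℝ) 1, HasDerivAt x (x' t) t) ∧
    ContinuousOn x' (Ioo 0 1) ∧ ContinuousOn y (Ioo 0 1) ∧
    (∀ t ∈ Ioo (0 : ℝ) 1, y t ^ 2 = U4 a c (x t) ∧ y t ≠ 0) ∧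
    Tendsto x (𝓝[>] 0) (𝓝 c) ∧
    Tendsto (fun t => (x t : OnePoint ℂ)) (𝓝[<] 1) (𝓝 p) ∧
    IntervalIntegrable (fun t => Complex.I * x' t / (2 * y t)) MeasureTheory.volume 0 1 ∧
    u = ∫ t in (0 : ℝ)..1, Complex.I * x' t / (2 * y t)

/-- The branch points `e_α` of the Weierstrass form `w² = 4 (z - e₁)(z - e₂)(z - e₃)` of the
curve `y² = U₄(x)`. -/
def e (a : Fin 3 → ℂ) (c : ℂ) (α : Fin 3) : ℂ :=
  ((a 0 * a 1 + a 1 * a 2 + a 2 * a 0) + c * (a 0 + a 1 + a 2)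
    - 3 * (a (α + 1) * a (α + 2) + c * a α)) / 3

/-- The Weierstrass sigma function of a lattice. -/
def sigma (L : PeriodPair) (u : ℂ) : ℂ :=
  u * ∏' w : {w : L.lattice // w ≠ 0},
    ((1 - u / (w.1 : ℂ)) * Complex.exp (u / (w.1 : ℂ) + (u / (w.1 : ℂ)) ^ 2 / 2))

/-- The Weierstrass zeta function `ζ = σ' / σ`. -/
def zeta (L : PeriodPair) (u : ℂ) : ℂ := deriv (sigma L) u / sigma L u

/-- `σ_α(u) = exp (η u) σ(Ω - u) / σ(Ω)`, with `η = ζ(Ω)`, for the half-period `Ω = Ω_α`. -/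
def sigmaHalf (L : PeriodPair) (Ω u : ℂ) : ℂ :=
  Complex.exp (zeta L Ω * u) * sigma L (Ω - u) / sigma L Ω

/-- `ε_α` is a square root of `1 / ((a_α - a_β)(a_α - a_γ))`, with the signs tied by
`1 / (ε₁ ε₂ ε₃) = i (a₁ - a₂)(a₂ - a₃)(a₃ - a₁)`. -/
def IsEps (a ε : Fin 3 → ℂ) : Prop :=
  (∀ α, ε α ^ 2 = 1 / ((a α - a (α + 1)) * (a α - a (α + 2)))) ∧
  1 / (ε 0 * ε 1 * ε 2) = Complex.I * ((a 0 - a 1) * (a 1 - a 2) * (a 2 - a 0))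

/-- `M_α(u) = m ε_α σ_α(u) / σ(u)`. -/
def solM (L : PeriodPair) (Ω : Fin 3 → ℂ) (m : ℂ) (ε : Fin 3 → ℂ) (u : ℂ) : Fin 3 → ℂ :=
  fun α => m * ε α * (sigmaHalf L (Ω α) u / sigma L u)

/-- `P_α(u) = ε_α (σ_α(u) / σ(u)) ∏_r σ(u + v_{r,α}) σ(u - v_{r,α}) / (σ(v_{r,α})² σ(u)²)`. -/
def solP (L : PeriodPair) (Ω : Fin 3 → ℂ) {s : ℕ} (v : Fin s → Fin 3 → ℂ) (ε : Fin 3 → ℂ)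
    (u : ℂ) : Fin 3 → ℂ :=
  fun α => ε α * (sigmaHalf L (Ω α) u / sigma L u) *
    ∏ r, (sigma L (u + v r α) * sigma L (u - v r α)) / (sigma L (v r α) ^ 2 * sigma L u ^ 2)

/-- The constant `Π`, computed from the values of `℘` at the half-period `Ω_α`. -/
def PiConst (L : PeriodPair) (Ω : Fin 3 → ℂ) {s : ℕ} (v : Fin s → Fin 3 → ℂ) (ε : Fin 3 → ℂ)
    (α β γ : Fin 3) : ℂ :=
  ε β ^ 2 * (L.weierstrassP (Ω α) - L.weierstrassP (Ω β)) *
      ∏ r, (L.weierstrassP (Ω α) - L.weierstrassP (v r β)) ^ 2 +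
    ε γ ^ 2 * (L.weierstrassP (Ω α) - L.weierstrassP (Ω γ)) *
      ∏ r, (L.weierstrassP (Ω α) - L.weierstrassP (v r γ)) ^ 2

end EulerPoisson

end

/-! Write `V` for `vand a` and `B` for the product of the `a_α - c`. The Möbius map `z = z_∞ - B /
(λ - c)` sends `c` to infinity and `a_α` to `e_α`, and turns `i dλ / (2 √U₄)` into `dz / w` on the
Weierstrass curve. Hence `℘` inverts the Abel integrals based at `c`: `℘(Ω_α) = e_α`, and `℘(v)` is
the image of the root `ρ` (`weierstrassP_of_isAbelIntegral`).

Euler equations. On the level set of the two integrals, `M_α² = m² ε_α² (z - e_α)` with one common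
`z`. The quotients `ξ_α = σ_α / σ` satisfy `ξ_α² = ℘ - e_α` and `ξ_α' = -ξ_β ξ_γ`, and the relation
between the signs of the `ε_α` turns these derivatives into the Euler equations. The curve `u ↦
M(u)` covers the level set, because periods and `u ↦ -u` realize all sign changes of the `ξ_α`;
uniqueness for differential equations then makes every solution a time shift of it (`eq_of_flow`).

Poisson equations. Both `A_n - A_{n+2}` and the derivative of `K` are multiples of `diag(ε_α²)`, the
factors being `2V` and `2V M₁M₂M₃`. So in the product `A_1⁻¹K A_3⁻¹K ⋯ T` the derivatives telescope:
each partial product has as derivative `M₁M₂M₃` times the preceding one, the process starting from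
`A_k T = 0` (`hasDerivAt_vecP`).

Sigma form. `F_{s,α}(λ) / (λ - c)^s` is a constant times the product of the `z - ℘(v_{r,α})`, and
`sigma_mul_sigma` converts each factor into sigma functions. The constant is governed by
`F_{s,α}(c)`, which is nonzero and the same for all `α`, since `T` is an eigenvector of every `A_n⁻¹
diag(ε_α²)`. This yields a single `κ`, and keeps the roots away from `c`, so that no `v_{r,α}` is a
period.

Real motions. The middle component of `M` must vanish at some time, for otherwise a Riccati equation
would blow up; that time serves as `t₀`. -/

namespace EulerPoisson

/-! ### The product for sigma: convergence, zeros, logarithmic derivative -/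

/-- The Weierstrass elementary factor of genus two with its zero at `w`. -/
noncomputable def sigmaFactor (w u : ℂ) : ℂ :=
  (1 - u / w) * Complex.exp (u / w + (u / w) ^ 2 / 2)

/-- The entire function `σ(u) / u`. -/
noncomputable def sigmaProd (L : PeriodPair) (u : ℂ) : ℂ :=
  ∏' w : {w : L.lattice // w ≠ 0}, sigmaFactor (w.1 : ℂ) u

theorem sigma_eq (L : PeriodPair) (u : ℂ) : sigma L u = u * sigmaProd L u := rfl

/-- The derivative of `(1 - z) exp(z + z²/2)` is `-z² exp(z + z²/2)`, of second order at `0`; the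
mean value inequality on the ball of radius `‖z‖` adds one more power. -/
theorem norm_elementaryFactor_sub_one_le {z : ℂ} (hz : ‖z‖ ≤ 1) :
    ‖(1 - z) * Complex.exp (z + z ^ 2 / 2) - 1‖ ≤ Real.exp 2 * ‖z‖ ^ 3 := by
  have h1 : ∀ x ∈ Metric.closedBall (0 : ℂ) ‖z‖, HasDerivWithinAt
      (fun z : ℂ => (1 - z) * Complex.exp (z + z ^ 2 / 2))
      (-x ^ 2 * Complex.exp (x + x ^ 2 / 2)) (Metric.closedBall (0 : ℂ) ‖z‖) x := by
    intro x _
    have h2 : HasDerivAt (fun z : ℂ => z + z ^ 2 / 2) (1 + x) x := by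
      have := (hasDerivAt_id x).add (((hasDerivAt_id x).pow 2).div_const 2)
      convert! this using 1
      simp
    have := ((hasDerivAt_id x).const_sub 1).mul h2.cexp
    refine HasDerivAt.hasDerivWithinAt ?_
    convert! this using 1
    simp
    ring
  have h2 : ∀ x ∈ Metric.closedBall (0 : ℂ) ‖z‖,
      ‖-x ^ 2 * Complex.exp (x + x ^ 2 / 2)‖ ≤ Real.exp 2 * ‖z‖ ^ 2 := by
    intro x hx
    have hx' : ‖x‖ ≤ ‖z‖ := by simpa using hx
    rw [norm_mul, norm_neg, norm_pow, mul_comm, Complex.norm_exp]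
    have : (x + x ^ 2 / 2).re ≤ 2 := by
      refine (Complex.re_le_norm _).trans ((norm_add_le _ _).trans ?_)
      rw [norm_div, norm_pow, Complex.norm_ofNat]
      have : ‖x‖ ≤ 1 := hx'.trans hz
      nlinarith [norm_nonneg x]
    gcongr
  have := (convex_closedBall (0 : ℂ) ‖z‖).norm_image_sub_le_of_norm_hasDerivWithin_le h1 h2
    (x := 0) (y := z) (by simp) (by simp)
  simp only [sub_zero, one_mul, ne_eq, OfNat.ofNat_ne_zero, not_false_eq_true, zero_pow, zero_div,
    add_zero, Complex.exp_zero, one_mul] at this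
  calc _ ≤ _ := this
    _ = _ := by ring

/-- A majorant uniform in the disc of radius `r`; the exponent `-3` is summable over a lattice of
rank two. -/
theorem norm_sigmaFactor_sub_one_le {w u : ℂ} {r : ℝ} (hu : ‖u‖ ≤ r) (hr : r ≤ ‖w‖)
    (hw : w ≠ 0) :
    ‖sigmaFactor w u - 1‖ ≤ Real.exp 2 * r ^ 3 * ‖w‖ ^ (-3 : ℝ) := by
  have hw' : 0 < ‖w‖ := norm_pos_iff.2 hw
  have h := norm_elementaryFactor_sub_one_le (z := u / w)
    (by rw [norm_div, div_le_one hw']; exact hu.trans hr)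
  refine h.trans ?_
  have : ‖w‖ ^ (-3 : ℝ) = (‖w‖ ^ 3)⁻¹ := by
    rw [Real.rpow_neg hw'.le]
    norm_cast
  rw [this, norm_div, div_pow, mul_assoc, ← div_eq_mul_inv]
  gcongr

theorem summable_norm_lattice (L : PeriodPair) :
    Summable fun w : {w : L.lattice // w ≠ 0} => ‖(w.1 : ℂ)‖ ^ (-3 : ℝ) := by
  have := ZLattice.summable_norm_rpow L.lattice (-3) (by simp; norm_num)
  exact this.comp_injective (i := fun w : {w : L.lattice // w ≠ 0} => w.1)
    Subtype.val_injective

theorem eventually_le_norm_lattice (L : PeriodPair) (r : ℝ) :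
    ∀ᶠ w : {w : L.lattice // w ≠ 0} in cofinite, r ≤ ‖(w.1 : ℂ)‖ := by
  have h : ∀ᶠ w : L.lattice in cofinite, r ≤ ‖(w : ℂ)‖ := by
    have := isCompact_iff_finite.mp (isCompact_closedBall (0 : L.lattice) r)
    refine this.subset ?_
    intro w hw
    simp only [mem_compl_iff, mem_ofPred_eq, not_le] at hw
    simpa using hw.le
  exact (Subtype.val_injective.tendsto_cofinite (α := {w : L.lattice // w ≠ 0})).eventually h

theorem differentiable_sigmaFactor (w : ℂ) : Differentiable ℂ (sigmaFactor w) := by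
  unfold sigmaFactor
  simp only [div_eq_mul_inv]
  fun_prop

theorem summable_norm_sigmaFactor_sub_one (L : PeriodPair) (u : ℂ) :
    Summable fun w : {w : L.lattice // w ≠ 0} => ‖sigmaFactor (w.1 : ℂ) u - 1‖ := by
  refine Summable.of_norm_bounded_eventually
    ((summable_norm_lattice L).mul_left (Real.exp 2 * ‖u‖ ^ 3)) ?_
  filter_upwards [eventually_le_norm_lattice L ‖u‖] with w hw
  rw [norm_norm]
  exact norm_sigmaFactor_sub_one_le le_rfl hw (by simpa using w.2)

theorem tendstoLocallyUniformlyOn_sigmaProd (L : PeriodPair) :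
    TendstoLocallyUniformlyOn
      (fun (s : Finset {w : L.lattice // w ≠ 0}) u => ∏ w ∈ s, sigmaFactor (w.1 : ℂ) u)
      (sigmaProd L) atTop univ := by
  refine tendstoLocallyUniformlyOn_of_forall_exists_nhds fun x _ => ?_
  refine ⟨Metric.closedBall 0 (‖x‖ + 1), ?_, ?_⟩
  · rw [nhdsWithin_univ]
    exact mem_of_superset (Metric.ball_mem_nhds x one_pos) fun y hy => by
      simp only [Metric.mem_ball, dist_eq_norm, Metric.mem_closedBall, sub_zero] at hy ⊢
      linarith [norm_le_norm_add_norm_sub' y x]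
  have := Summable.hasProdUniformlyOn_one_add
    (f := fun (w : {w : L.lattice // w ≠ 0}) u => sigmaFactor (w.1 : ℂ) u - 1)
    (isCompact_closedBall (0 : ℂ) (‖x‖ + 1))
    ((summable_norm_lattice L).mul_left (Real.exp 2 * (‖x‖ + 1) ^ 3)) ?_ ?_
  · rw [hasProdUniformlyOn_iff_tendstoUniformlyOn] at this
    simpa only [add_sub_cancel] using! this
  · filter_upwards [eventually_le_norm_lattice L (‖x‖ + 1)] with w hw u hu
    exact norm_sigmaFactor_sub_one_le (by simpa using hu) hw (by simpa using w.2)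
  · exact fun w => ((differentiable_sigmaFactor _).continuous.sub continuous_const).continuousOn

theorem differentiable_sigmaProd (L : PeriodPair) : Differentiable ℂ (sigmaProd L) := by
  rw [← differentiableOn_univ]
  refine (tendstoLocallyUniformlyOn_sigmaProd L).differentiableOn
    (.of_forall fun s => ?_) isOpen_univ
  exact (Differentiable.fun_finsetProd fun w _ => differentiable_sigmaFactor _).differentiableOn

theorem differentiable_sigma (L : PeriodPair) : Differentiable ℂ (sigma L) :=
  differentiable_id.mul (differentiable_sigmaProd L)

theorem sigmaProd_zero (L : PeriodPair) : sigmaProd L 0 = 1 := by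
  simp [sigmaProd, sigmaFactor]

theorem sigmaProd_neg (L : PeriodPair) (u : ℂ) : sigmaProd L (-u) = sigmaProd L u := by
  unfold sigmaProd
  let φ : {w : L.lattice // w ≠ 0} ≃ {w : L.lattice // w ≠ 0} :=
    (Equiv.neg L.lattice).subtypeEquiv fun w => by simp
  rw [← φ.tprod_eq]
  refine tprod_congr fun w => ?_
  have : ((φ w).1 : ℂ) = -(w.1 : ℂ) := rfl
  simp [this, sigmaFactor]

theorem sigma_neg (L : PeriodPair) (u : ℂ) : sigma L (-u) = -sigma L u := by
  rw [sigma_eq, sigma_eq, sigmaProd_neg, neg_mul]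

theorem sigmaFactor_ne_zero {w u : ℂ} (hw : w ≠ 0) (h : u ≠ w) : sigmaFactor w u ≠ 0 := by
  refine mul_ne_zero (fun h0 => h ?_) (Complex.exp_ne_zero _)
  rw [sub_eq_zero, eq_comm, div_eq_one_iff_eq hw] at h0
  exact h0

theorem sigmaProd_ne_zero (L : PeriodPair) {u : ℂ} (hu : u ∉ (L.lattice : Set ℂ) \ {0}) :
    sigmaProd L u ≠ 0 := by
  have := tprod_one_add_ne_zero_of_summable (R := ℂ)
    (f := fun w : {w : L.lattice // w ≠ 0} => sigmaFactor (w.1 : ℂ) u - 1) ?_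
    (summable_norm_sigmaFactor_sub_one L u)
  · simpa only [add_sub_cancel] using! this
  · intro w
    rw [add_sub_cancel]
    refine sigmaFactor_ne_zero (by simpa using w.2) ?_
    rintro rfl
    exact hu ⟨w.1.2, by simpa using w.2⟩

theorem sigma_ne_zero (L : PeriodPair) {u : ℂ} (hu : u ∉ L.lattice) : sigma L u ≠ 0 := by
  rw [sigma_eq]
  refine mul_ne_zero (fun h => hu (h ▸ L.lattice.zero_mem)) (sigmaProd_ne_zero L fun h => hu h.1)

theorem sigma_eq_zero (L : PeriodPair) {u : ℂ} (hu : u ∈ L.lattice) : sigma L u = 0 := by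
  rw [sigma_eq]
  by_cases h0 : u = 0
  · simp [h0]
  refine mul_eq_zero_of_right _ ?_
  refine tprod_of_exists_eq_zero ⟨⟨⟨u, hu⟩, by simpa using h0⟩, ?_⟩
  simp [sigmaFactor, div_self h0]

theorem sigma_eq_zero_iff (L : PeriodPair) {u : ℂ} : sigma L u = 0 ↔ u ∈ L.lattice :=
  ⟨fun h => by_contra fun hu => sigma_ne_zero L hu h, sigma_eq_zero L⟩

theorem logDeriv_sigmaFactor {w z : ℂ} (hw : w ≠ 0) (h : z ≠ w) :
    logDeriv (sigmaFactor w) z = 1 / (z - w) + 1 / w + z / w ^ 2 := by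
  have hzw : z - w ≠ 0 := sub_ne_zero.2 h
  have hwz : w - z ≠ 0 := sub_ne_zero.2 h.symm
  have h1 : HasDerivAt (fun u : ℂ => u / w) (1 / w) z := (hasDerivAt_id z).div_const w
  have h2 : HasDerivAt (fun u : ℂ => u / w + (u / w) ^ 2 / 2) (1 / w + z / w ^ 2) z := by
    have := h1.add ((h1.pow 2).div_const 2)
    convert! this using 1
    simp
    field_simp
  have h3 : HasDerivAt (sigmaFactor w) _ z := (h1.const_sub 1).mul h2.cexp
  have h0 := sigmaFactor_ne_zero hw h
  rw [logDeriv_apply, h3.deriv, div_eq_iff h0, sigmaFactor]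
  field_simp
  ring

/-- The logarithmic derivative of `σ(u) / u` has the derivative `u⁻² - ℘(u)`. -/
theorem hasDerivAt_logDeriv_sigmaProd (L : PeriodPair) {u : ℂ} (hu : u ∉ L.lattice) :
    HasDerivAt (fun z => deriv (sigmaProd L) z / sigmaProd L z)
      (1 / u ^ 2 - L.weierstrassP u) u := by
  set F : Finset {w : L.lattice // w ≠ 0} → ℂ → ℂ :=
    fun s u => ∏ w ∈ s, sigmaFactor (w.1 : ℂ) u with hF
  have hFd : ∀ s, Differentiable ℂ (F s) := fun s =>
    Differentiable.fun_finsetProd fun w _ => differentiable_sigmaFactor _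
  have hd : ∀ {g : ℂ → ℂ}, Differentiable ℂ g → Differentiable ℂ (deriv g) := fun hg => by
    simpa [differentiableOn_univ] using (differentiableOn_univ.2 hg).deriv isOpen_univ
  -- Locally uniform limits of holomorphic functions may be differentiated, so `g''/g - (g'/g)²` is
  -- the limit of its values on finite products, where it is a finite sum over lattice points.
  have t0 := tendstoLocallyUniformlyOn_sigmaProd L
  have t1 := t0.deriv (.of_forall fun s => (hFd s).differentiableOn) isOpen_univ
  have t2 := t1.deriv (.of_forall fun s => (hd (hFd s)).differentiableOn) isOpen_univ
  have p0 := t0.tendsto_at (mem_univ u)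
  have p1 := t1.tendsto_at (mem_univ u)
  have p2 := t2.tendsto_at (mem_univ u)
  have hne : sigmaProd L u ≠ 0 := sigmaProd_ne_zero L fun h => hu h.1
  have hFne : ∀ s, F s u ≠ 0 := fun s => Finset.prod_ne_zero_iff.2 fun w _ =>
    sigmaFactor_ne_zero (by simpa using w.2) (by rintro rfl; exact hu w.1.2)
  have key : ∀ {g : ℂ → ℂ}, Differentiable ℂ g → g u ≠ 0 →
      HasDerivAt (fun z => deriv g z / g z)
        (deriv (deriv g) u / g u - (deriv g u / g u) ^ 2) u := by
    intro g hg h0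
    have := (hd hg u).hasDerivAt.div (hg u).hasDerivAt h0
    convert! this using 1
    field_simp
  have h1 := key (differentiable_sigmaProd L) hne
  have lim1 : Tendsto (fun s => deriv (deriv (F s)) u / F s u - (deriv (F s) u / F s u) ^ 2) atTop
      (𝓝 (deriv (deriv (sigmaProd L)) u / sigmaProd L u
        - (deriv (sigmaProd L) u / sigmaProd L u) ^ 2)) :=
    (p2.div p0 hne).sub ((p1.div p0 hne).pow 2)
  have hsum : HasSum (fun w : {w : L.lattice // w ≠ 0} =>
      -(1 / (u - (w.1 : ℂ)) ^ 2 - 1 / (w.1 : ℂ) ^ 2)) (1 / u ^ 2 - L.weierstrassP u) := by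
    have h := L.hasSum_weierstrassP u
    have h' := (hasSum_subtype_iff_indicator (s := {w : L.lattice | w ≠ 0})
      (f := fun w : L.lattice => 1 / (u - (w : ℂ)) ^ 2 - 1 / (w : ℂ) ^ 2)
      (a := L.weierstrassP u - 1 / u ^ 2)).2 ?_
    · simpa using! h'.neg
    -- The series for `℘` runs over the whole lattice; as `1 / 0 = 0`, its term at the origin is `1
    -- / u²`, which is split off here.
    have h0 := hasSum_ite_eq (0 : L.lattice) (1 / u ^ 2)
    refine (h.sub h0).congr_fun ?_
    intro w
    by_cases hw : w = 0 <;> simp [hw, Set.indicator]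
  have lim2 : Tendsto (fun s => deriv (deriv (F s)) u / F s u - (deriv (F s) u / F s u) ^ 2) atTop
      (𝓝 (1 / u ^ 2 - L.weierstrassP u)) := by
    refine hsum.congr fun s => ?_
    refine HasDerivAt.unique (f := fun z => deriv (F s) z / F s z) (x := u) ?_ (key (hFd s) (hFne s))
    have hfac : ∀ w : {w : L.lattice // w ≠ 0}, ∀ z : ℂ, z ∉ L.lattice →
        logDeriv (sigmaFactor (w.1 : ℂ)) z = 1 / (z - w.1) + 1 / w.1 + z / (w.1 : ℂ) ^ 2 :=
      fun w z hz => logDeriv_sigmaFactor (by simpa using w.2) (by rintro rfl; exact hz w.1.2)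
    have hev : (fun z => deriv (F s) z / F s z) =ᶠ[𝓝 u]
        fun z => ∑ w ∈ s, (1 / (z - (w.1 : ℂ)) + 1 / w.1 + z / (w.1 : ℂ) ^ 2) := by
      filter_upwards [L.isClosed_lattice.isOpen_compl.mem_nhds hu] with z hz
      rw [← logDeriv_apply, hF, logDeriv_prod]
      · exact Finset.sum_congr rfl fun w _ => hfac w z hz
      · exact fun w _ => sigmaFactor_ne_zero (by simpa using w.2) (by rintro rfl; exact hz w.1.2)
      · exact fun w _ => differentiable_sigmaFactor _ z
    refine HasDerivAt.congr_of_eventuallyEq ?_ hev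
    refine HasDerivAt.fun_sum fun w _ => ?_
    have hw : u - (w.1 : ℂ) ≠ 0 := by rw [sub_ne_zero]; rintro rfl; exact hu w.1.2
    have := ((((hasDerivAt_id u).sub_const (w.1 : ℂ)).inv hw).add_const (1 / (w.1 : ℂ))).add
      ((hasDerivAt_id u).div_const ((w.1 : ℂ) ^ 2))
    convert! this using 1
    · ext z
      simp
    · simp only [id]
      field_simp
      ring
  rw [tendsto_nhds_unique lim2 lim1]
  exact h1

/-! ### The zeta function and the quasi-periodicity of sigma -/

theorem isPreconnected_compl_lattice (L : PeriodPair) :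
    IsPreconnected ((L.lattice : Set ℂ)ᶜ) := by
  refine (Set.Countable.isConnected_compl_of_one_lt_rank ?_ ?_).isPreconnected
  · rw [Complex.rank_real_complex]; norm_num
  · exact Set.countable_coe_iff.1 (inferInstanceAs (Countable L.lattice))

theorem isOpen_compl_lattice (L : PeriodPair) : IsOpen ((L.lattice : Set ℂ)ᶜ) :=
  L.isClosed_lattice.isOpen_compl

theorem add_mem_lattice_iff (L : PeriodPair) {u w : ℂ} (hw : w ∈ L.lattice) :
    u + w ∈ L.lattice ↔ u ∈ L.lattice :=
  ⟨fun h => by simpa using L.lattice.sub_mem h hw, fun h => L.lattice.add_mem h hw⟩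

theorem exists_notMem_lattice (L : PeriodPair) : ∃ u : ℂ, u ∉ L.lattice :=
  ⟨_, L.ω₁_div_two_notMem_lattice⟩

theorem hasDerivAt_sigma (L : PeriodPair) {u : ℂ} (hu : u ∉ L.lattice) :
    HasDerivAt (sigma L) (zeta L u * sigma L u) u := by
  have := (differentiable_sigma L u).hasDerivAt
  rwa [zeta, div_mul_cancel₀ _ (sigma_ne_zero L hu)]

theorem zeta_eq (L : PeriodPair) {u : ℂ} (hu : u ∉ L.lattice) :
    zeta L u = 1 / u + deriv (sigmaProd L) u / sigmaProd L u := by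
  have h0 : u ≠ 0 := fun h => hu (h ▸ L.lattice.zero_mem)
  have h1 : sigmaProd L u ≠ 0 := sigmaProd_ne_zero L fun h => hu h.1
  have h2 : HasDerivAt (sigma L) (1 * sigmaProd L u + u * deriv (sigmaProd L) u) u :=
    (hasDerivAt_id u).mul (differentiable_sigmaProd L u).hasDerivAt
  rw [zeta, h2.deriv, sigma_eq]
  field_simp

theorem hasDerivAt_zeta (L : PeriodPair) {u : ℂ} (hu : u ∉ L.lattice) :
    HasDerivAt (zeta L) (-L.weierstrassP u) u := by
  have h0 : u ≠ 0 := fun h => hu (h ▸ L.lattice.zero_mem)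
  have hev : zeta L =ᶠ[𝓝 u] fun z => z⁻¹ + deriv (sigmaProd L) z / sigmaProd L z := by
    filter_upwards [(isOpen_compl_lattice L).mem_nhds hu] with z hz
    rw [zeta_eq L hz, one_div]
  refine HasDerivAt.congr_of_eventuallyEq ?_ hev
  have := (hasDerivAt_inv h0).add (hasDerivAt_logDeriv_sigmaProd L hu)
  convert! this using 1
  field_simp
  ring

theorem zeta_neg (L : PeriodPair) (u : ℂ) : zeta L (-u) = -zeta L u := by
  have h : HasDerivAt (fun z => sigma L (-z)) (deriv (sigma L) (-u) * -1) u :=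
    (differentiable_sigma L (-u)).hasDerivAt.comp u (hasDerivAt_neg u)
  have h2 : HasDerivAt (fun z => sigma L (-z)) (-deriv (sigma L) u) u := by
    simp only [sigma_neg]
    exact (differentiable_sigma L u).hasDerivAt.neg
  have := h.unique h2
  rw [zeta, zeta, sigma_neg, div_neg, ← neg_div]
  rw [mul_neg_one, neg_inj] at this
  rw [this, neg_div]

/-- `ζ(u + w) - ζ(u)` has derivative zero by periodicity of `℘`, hence is a constant `η`; then so is
`σ(u + w) / (exp(ηu) σ(u))`, because the complement of the lattice is connected. -/
theorem sigma_add_lattice (L : PeriodPair) {w : ℂ} (hw : w ∈ L.lattice) :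
    ∃ η C : ℂ, (∀ u ∉ L.lattice, zeta L (u + w) = zeta L u + η) ∧
      ∀ u, sigma L (u + w) = C * Complex.exp (η * u) * sigma L u := by
  have hsh : ∀ {u : ℂ}, u ∉ L.lattice → u + w ∉ L.lattice := fun hu h =>
    hu ((add_mem_lattice_iff L hw).1 h)
  obtain ⟨η, hη⟩ := (isOpen_compl_lattice L).exists_is_const_of_deriv_eq_zero (𝕜 := ℂ)
    (f := fun u => zeta L (u + w) - zeta L u) (isPreconnected_compl_lattice L)
    (fun u hu => (((hasDerivAt_zeta L (hsh hu)).comp_add_const u w).sub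
      (hasDerivAt_zeta L hu)).differentiableAt.differentiableWithinAt)
    (fun u hu => by
      refine (((hasDerivAt_zeta L (hsh hu)).comp_add_const u w).sub
        (hasDerivAt_zeta L hu)).deriv.trans ?_
      rw [L.weierstrassP_add_coe u ⟨w, hw⟩, sub_self, Pi.zero_apply])
  have hη' : ∀ u ∉ L.lattice, zeta L (u + w) = zeta L u + η := fun u hu => by
    rw [← hη u hu]; ring
  have hder : ∀ u ∉ L.lattice, HasDerivAt
      (fun u => sigma L (u + w) / (Complex.exp (η * u) * sigma L u)) 0 u := by
    intro u hu
    have h1 := (hasDerivAt_sigma L (hsh hu)).comp_add_const u w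
    have h2 := (((hasDerivAt_id u).const_mul η).cexp).mul (hasDerivAt_sigma L hu)
    have h3 := h1.div h2 (mul_ne_zero (Complex.exp_ne_zero _) (sigma_ne_zero L hu))
    convert! h3 using 1
    rw [hη' u hu]
    simp only [id, Pi.mul_apply, mul_one]
    rw [eq_comm, div_eq_zero_iff]
    left
    ring
  obtain ⟨C, hC⟩ := (isOpen_compl_lattice L).exists_is_const_of_deriv_eq_zero (𝕜 := ℂ)
    (isPreconnected_compl_lattice L)
    (fun u hu => (hder u hu).differentiableAt.differentiableWithinAt)
    (fun u hu => (hder u hu).deriv)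
  refine ⟨η, C, hη', fun u => ?_⟩
  by_cases hu : u ∈ L.lattice
  · rw [sigma_eq_zero L hu, sigma_eq_zero L ((add_mem_lattice_iff L hw).2 hu), mul_zero]
  · have := hC u hu
    rw [div_eq_iff (mul_ne_zero (Complex.exp_ne_zero _) (sigma_ne_zero L hu))] at this
    rw [this]; ring

/-- Both constants of `sigma_add_lattice` are read off at `u = -Ω`, where the shift by `2Ω` gives
`Ω` and oddness applies. -/
theorem sigma_add_two_mul (L : PeriodPair) {Ω : ℂ} (h : Ω ∉ L.lattice) (h2 : 2 * Ω ∈ L.lattice)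
    (u : ℂ) :
    sigma L (u + 2 * Ω) = -Complex.exp (2 * zeta L Ω * (u + Ω)) * sigma L u := by
  obtain ⟨η, C, hη, hC⟩ := sigma_add_lattice L h2
  have hn : -Ω ∉ L.lattice := fun h' => h (by simpa using L.lattice.neg_mem h')
  have e1 := hη _ hn
  have e2 := hC (-Ω)
  have hs := sigma_ne_zero L h
  rw [show -Ω + 2 * Ω = Ω by ring] at e1 e2
  rw [zeta_neg] at e1
  rw [sigma_neg] at e2
  have hη2 : η = 2 * zeta L Ω := by linear_combination -e1
  have hCe : C = -Complex.exp (η * Ω) := by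
    have : C * Complex.exp (η * -Ω) = -1 := mul_right_cancel₀ hs (by linear_combination e2)
    calc C = C * Complex.exp (η * -Ω) * Complex.exp (η * Ω) := by
          rw [mul_assoc, ← Complex.exp_add]; simp
      _ = _ := by rw [this]; ring
  rw [hC, hCe, hη2, mul_add, Complex.exp_add]
  ring

/-! ### Liouville's theorem for elliptic functions and its consequences for `℘` -/

/-- An elliptic function whose poles are removable is constant. -/
theorem elliptic_liouville (L : PeriodPair) {f g : ℂ → ℂ}
    (hf : ∀ u ∉ L.lattice, DifferentiableAt ℂ f u)
    (hper : ∀ w ∈ L.lattice, ∀ u ∉ L.lattice, f (u + w) = f u)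
    (hg : AnalyticAt ℂ g 0) (hfg : f =ᶠ[𝓝[≠] 0] g) : ∀ u ∉ L.lattice, f u = g 0 := by
  classical
  -- Filled in with `g 0` on the lattice, `f` becomes entire and periodic; its range is then
  -- compact.
  set F : ℂ → ℂ := fun u => if u ∈ L.lattice then g 0 else f u with hF
  have hFper : ∀ u w, w ∈ L.lattice → F (u + w) = F u := by
    intro u w hw
    by_cases hu : u ∈ L.lattice
    · simp [hF, hu, (add_mem_lattice_iff L hw).2 hu]
    · simp only [hF, hu, mt (add_mem_lattice_iff L hw).1 hu, if_false]
      exact hper w hw u hu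
  have hF0 : DifferentiableAt ℂ F 0 := by
    refine hg.differentiableAt.congr_of_eventuallyEq ?_
    have h1 := eventually_nhdsWithin_iff.1 hfg
    filter_upwards [h1, L.compl_lattice_sdiff_singleton_mem_nhds 0] with z hz hz'
    by_cases h0 : z = 0
    · simp [hF, h0]
    · have : z ∉ L.lattice := fun h => hz' ⟨h, h0⟩
      simp only [hF, this, if_false]
      exact hz h0
  have hFd : Differentiable ℂ F := by
    intro u
    by_cases hu : u ∈ L.lattice
    · have h1 : DifferentiableAt ℂ (fun z => F (z + -u)) u :=
        differentiableAt_comp_add_const.2 (by simpa using hF0)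
      refine h1.congr_of_eventuallyEq (.of_forall fun z => ?_)
      exact (hFper z (-u) (L.lattice.neg_mem hu)).symm
    · refine (hf u hu).congr_of_eventuallyEq ?_
      filter_upwards [(isOpen_compl_lattice L).mem_nhds hu] with z hz
      have : z ∉ L.lattice := hz
      simp [hF, this]
  have hb := IsZLattice.isCompact_range_of_periodic L.lattice F hFd.continuous hFper
  intro u hu
  have := hFd.apply_eq_apply_of_bounded hb.isBounded u 0
  simpa [hF, hu] using this

theorem weierstrassP_eq_of_ne_zero (L : PeriodPair) (z : ℂ) :
    L.weierstrassP z = L.weierstrassPExcept 0 z + 1 / z ^ 2 := by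
  have := L.weierstrassPExcept_add 0 z
  simp at this
  rw [← this]
  simp

theorem analyticAt_weierstrassPExcept_zero (L : PeriodPair) :
    AnalyticAt ℂ (L.weierstrassPExcept 0) 0 := L.analyticAt_weierstrassPExcept 0

theorem weierstrassP_add (L : PeriodPair) (z : ℂ) {w : ℂ} (hw : w ∈ L.lattice) :
    L.weierstrassP (z + w) = L.weierstrassP z := L.weierstrassP_add_coe z ⟨w, hw⟩

theorem hasDerivAt_weierstrassP (L : PeriodPair) {u : ℂ} (hu : u ∉ L.lattice) :
    HasDerivAt L.weierstrassP (L.derivWeierstrassP u) u := by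
  have := (L.differentiableOn_weierstrassP.differentiableAt
    ((isOpen_compl_lattice L).mem_nhds hu)).hasDerivAt
  rwa [L.deriv_weierstrassP] at this

theorem tendsto_weierstrassP_cobounded (L : PeriodPair) {w : ℂ} (hw : w ∈ L.lattice) :
    Tendsto L.weierstrassP (𝓝[≠] w) (Bornology.cobounded ℂ) := by
  refine tendsto_cobounded_of_meromorphicOrderAt_neg ?_
  rw [L.order_weierstrassP w hw]
  decide

/-- If `℘` omitted the value `z`, then `1 / (℘ - z)` would be elliptic without poles and zero on the
lattice, hence identically zero. -/
theorem exists_weierstrassP_eq (L : PeriodPair) (z : ℂ) :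
    ∃ u ∉ L.lattice, L.weierstrassP u = z := by
  by_contra! hne
  have hana := analyticAt_weierstrassPExcept_zero L
  have h := elliptic_liouville L (f := fun u => 1 / (L.weierstrassP u - z))
    (g := fun u => u ^ 2 / (u ^ 2 * L.weierstrassPExcept 0 u + 1 - u ^ 2 * z)) ?_ ?_ ?_ ?_
  · obtain ⟨u, hu⟩ := exists_notMem_lattice L
    have := h u hu
    simp [sub_eq_zero, hne u hu] at this
  · intro u hu
    exact (differentiableAt_const _).div
      ((hasDerivAt_weierstrassP L hu).differentiableAt.sub_const z) (sub_ne_zero.2 (hne u hu))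
  · intro w hw u _
    simp only [weierstrassP_add L u hw]
  · refine AnalyticAt.div (by fun_prop) (by fun_prop) (by simp)
  · filter_upwards [self_mem_nhdsWithin] with u hu
    have hu : u ≠ 0 := hu
    rw [weierstrassP_eq_of_ne_zero]
    field_simp

/-- The derivative of an even function vanishes at `0`, so the difference quotient can be taken
twice. This removes the double pole in `sigma_mul_sigma`. -/
theorem exists_sub_eq_sq_mul {q : ℂ → ℂ} (hq : AnalyticAt ℂ q 0) (heven : ∀ u, q (-u) = q u) :
    ∃ r : ℂ → ℂ, AnalyticAt ℂ r 0 ∧ ∀ u, q u - q 0 = u ^ 2 * r u := by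
  have han : ∀ {p : ℂ → ℂ}, AnalyticAt ℂ p 0 → AnalyticAt ℂ (dslope p 0) 0 := by
    intro p hp
    obtain ⟨P, hP⟩ := hp
    exact ⟨_, hP.has_fpower_series_dslope_fslope⟩
  have hd0 : dslope q 0 0 = 0 := by
    rw [dslope_same]
    have h1 : HasDerivAt (fun z => q (-z)) (deriv q (-0) * -1) 0 := by
      have : DifferentiableAt ℂ q (-0) := by simpa using hq.differentiableAt
      exact this.hasDerivAt.comp 0 (hasDerivAt_neg 0)
    have h2 : HasDerivAt (fun z => q (-z)) (deriv q 0) 0 := by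
      simp only [heven]
      exact hq.differentiableAt.hasDerivAt
    have := h1.unique h2
    rw [neg_zero] at this
    linear_combination (-1 / 2 : ℂ) * this
  refine ⟨dslope (dslope q 0) 0, han (han hq), fun u => ?_⟩
  have h1 := sub_smul_dslope q 0 u
  have h2 := sub_smul_dslope (dslope q 0) 0 u
  simp only [sub_zero, smul_eq_mul, hd0] at h1 h2
  rw [← h1, ← h2]
  ring

/-- As a function of `u`, the left side is elliptic, since the multipliers of the sigma factors
cancel, and even; its principal part at `0` is `-1/u²`. Adding `℘(u)` leaves no pole, so the sum is
constant. -/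
theorem sigma_mul_sigma (L : PeriodPair) {u v : ℂ} (hu : u ∉ L.lattice) (hv : v ∉ L.lattice) :
    sigma L (u + v) * sigma L (u - v) / (sigma L v ^ 2 * sigma L u ^ 2) =
      L.weierstrassP v - L.weierstrassP u := by
  have hsv := sigma_ne_zero L hv
  have hd := differentiable_sigma L
  set q : ℂ → ℂ := fun u => sigma L (u + v) * sigma L (u - v) /
    (sigma L v ^ 2 * sigmaProd L u ^ 2) with hqdef
  have hq : AnalyticAt ℂ q 0 := by
    have h1 : AnalyticAt ℂ (sigmaProd L) 0 := (differentiable_sigmaProd L).analyticAt 0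
    have h2 : AnalyticAt ℂ (fun u => sigma L (u + v)) 0 :=
      Differentiable.analyticAt (hd.comp (differentiable_id.add_const v)) 0
    have h3 : AnalyticAt ℂ (fun u => sigma L (u - v)) 0 :=
      Differentiable.analyticAt (hd.comp (differentiable_id.sub_const v)) 0
    exact (h2.mul h3).div (analyticAt_const.mul (h1.pow 2)) (by simp [sigmaProd_zero, hsv])
  have hev : ∀ u, q (-u) = q u := by
    intro u
    simp only [hqdef, sigmaProd_neg]
    rw [show -u + v = -(u - v) by ring, show -u - v = -(u + v) by ring, sigma_neg, sigma_neg]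
    ring
  have hq0 : q 0 = -1 := by
    simp only [hqdef, zero_add, zero_sub, sigma_neg, sigmaProd_zero]
    field_simp
  obtain ⟨r, hr, hqr⟩ := exists_sub_eq_sq_mul hq hev
  have hfac : ∀ u, u ≠ 0 → sigma L (u + v) * sigma L (u - v) / (sigma L v ^ 2 * sigma L u ^ 2) =
      q u / u ^ 2 := by
    intro u hu
    simp only [hqdef, sigma_eq L u, div_div]
    congr 1
    ring
  have h := elliptic_liouville L
    (f := fun u => sigma L (u + v) * sigma L (u - v) / (sigma L v ^ 2 * sigma L u ^ 2)
      + L.weierstrassP u)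
    (g := fun u => r u + L.weierstrassPExcept 0 u) ?_ ?_
    (hr.add (analyticAt_weierstrassPExcept_zero L)) ?_
  · have e1 := h u hu
    -- At `u = v` the sigma quotient vanishes, so the constant is `℘(v)`.
    have e2 := h v hv
    simp only [sub_self, sigma_eq_zero L L.lattice.zero_mem, mul_zero, zero_div, zero_add] at e2
    rw [← e2] at e1
    linear_combination e1
  · intro u hu
    refine DifferentiableAt.add ?_ (hasDerivAt_weierstrassP L hu).differentiableAt
    refine DifferentiableAt.div ?_ ?_ (mul_ne_zero (pow_ne_zero _ hsv)
      (pow_ne_zero _ (sigma_ne_zero L hu)))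
    · exact ((hd.comp (differentiable_id.add_const v)) u).mul
        ((hd.comp (differentiable_id.sub_const v)) u)
    · exact (differentiableAt_const _).mul ((hd u).pow 2)
  · intro w hw u hu
    obtain ⟨η, C, -, hC⟩ := sigma_add_lattice L hw
    have hC0 : C ≠ 0 := by
      rintro rfl
      have := hC u
      simp only [zero_mul] at this
      exact hu ((add_mem_lattice_iff L hw).1 ((sigma_eq_zero_iff L).1 this))
    have hsu := sigma_ne_zero L hu
    have he := Complex.exp_ne_zero (η * u)
    simp only [weierstrassP_add L u hw, add_left_inj]
    rw [show u + w + v = (u + v) + w by ring, show u + w - v = (u - v) + w by ring, hC, hC, hC,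
      mul_add, mul_sub, Complex.exp_add, Complex.exp_sub]
    have he' := Complex.exp_ne_zero (η * v)
    field_simp
  · filter_upwards [self_mem_nhdsWithin] with u hu
    have hu : u ≠ 0 := hu
    have := hqr u
    rw [hq0] at this
    rw [hfac u hu, weierstrassP_eq_of_ne_zero, show q u = u ^ 2 * r u - 1 by
      linear_combination this]
    field_simp
    ring

theorem weierstrassP_eq_iff (L : PeriodPair) {u v : ℂ} (hu : u ∉ L.lattice) (hv : v ∉ L.lattice) :
    L.weierstrassP u = L.weierstrassP v ↔ u + v ∈ L.lattice ∨ u - v ∈ L.lattice := by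
  have h := sigma_mul_sigma L hu hv
  have hd : sigma L v ^ 2 * sigma L u ^ 2 ≠ 0 :=
    mul_ne_zero (pow_ne_zero _ (sigma_ne_zero L hv)) (pow_ne_zero _ (sigma_ne_zero L hu))
  rw [← sigma_eq_zero_iff, ← sigma_eq_zero_iff, ← mul_eq_zero, eq_comm, ← sub_eq_zero, ← h,
    div_eq_zero_iff, or_iff_left hd]

theorem exists_derivWeierstrassP_ne_zero (L : PeriodPair) :
    ∃ u ∉ L.lattice, L.derivWeierstrassP u ≠ 0 := by
  by_contra! h
  obtain ⟨c, hc⟩ := (isOpen_compl_lattice L).exists_is_const_of_deriv_eq_zero (𝕜 := ℂ)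
    (isPreconnected_compl_lattice L) L.differentiableOn_weierstrassP
    (fun u hu => by rw [L.deriv_weierstrassP]; exact h u hu)
  obtain ⟨u, hu, hu'⟩ := exists_weierstrassP_eq L (c + 1)
  rw [hc u hu] at hu'
  simp at hu'

/-- Differentiating `℘'² = 4℘³ - g₂℘ - g₃` gives the claim multiplied by `℘'`; the factor cancels
because analytic functions on a connected set have no zero divisors. -/
theorem hasDerivAt_derivWeierstrassP (L : PeriodPair) {u : ℂ} (hu : u ∉ L.lattice) :
    HasDerivAt L.derivWeierstrassP (6 * L.weierstrassP u ^ 2 - L.g₂ / 2) u := by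
  have hd : ∀ u ∉ L.lattice, HasDerivAt L.derivWeierstrassP (deriv L.derivWeierstrassP u) u :=
    fun u hu => (L.differentiableOn_derivWeierstrassP.differentiableAt
      ((isOpen_compl_lattice L).mem_nhds hu)).hasDerivAt
  have ha := L.analyticOnNhd_derivWeierstrassP
  have h := AnalyticOnNhd.eq_zero_or_eq_zero_of_mul_eq_zero
    (f := fun u => deriv L.derivWeierstrassP u - (6 * L.weierstrassP u ^ 2 - L.g₂ / 2))
    (ha.deriv.sub (((analyticOnNhd_const (v := (6 : ℂ))).mul
      (L.analyticOnNhd_weierstrassP.pow 2)).sub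
      (analyticOnNhd_const (v := L.g₂ / 2)))) ha (fun u hu => ?_) (isPreconnected_compl_lattice L)
  · obtain h | h := h
    · have := h u hu
      rw [← sub_eq_zero.1 this]
      exact hd u hu
    · obtain ⟨v, hv, hv'⟩ := exists_derivWeierstrassP_ne_zero L
      exact absurd (h v hv) hv'
  · have h1 := (hd u hu).pow 2
    have hp := hasDerivAt_weierstrassP L hu
    have h2 := (((hp.pow 3).const_mul 4).sub (hp.const_mul L.g₂)).sub_const L.g₃
    have h3 := h2.congr_of_eventuallyEq (f₁ := fun u => L.derivWeierstrassP u ^ 2) (by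
      filter_upwards [(isOpen_compl_lattice L).mem_nhds hu] with z hz
      simpa using L.derivWeierstrassP_sq z hz)
    have := h1.unique h3
    simp at this
    linear_combination this / 2

/-! ### The quotients `ξ_α = σ_α / σ` -/

/-- The quotient `σ_α / σ` for the half-period `Ω = Ω_α`. -/
noncomputable def xi (L : PeriodPair) (Ω u : ℂ) : ℂ := sigmaHalf L Ω u / sigma L u

theorem differentiable_sigmaHalf (L : PeriodPair) (Ω : ℂ) : Differentiable ℂ (sigmaHalf L Ω) := by
  unfold sigmaHalf
  exact (((differentiable_id.const_mul _).cexp.mul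
    ((differentiable_sigma L).comp (differentiable_id.const_sub Ω))).div_const _)

theorem differentiableAt_xi (L : PeriodPair) (Ω : ℂ) {u : ℂ} (hu : u ∉ L.lattice) :
    DifferentiableAt ℂ (xi L Ω) u :=
  (differentiable_sigmaHalf L Ω u).div (differentiable_sigma L u) (sigma_ne_zero L hu)

theorem sigma_add_half (L : PeriodPair) {Ω : ℂ} (h : Ω ∉ L.lattice) (h2 : 2 * Ω ∈ L.lattice)
    (u : ℂ) : sigma L (u + Ω) = Complex.exp (2 * zeta L Ω * u) * sigma L (Ω - u) := by
  have := sigma_add_two_mul L h h2 (u - Ω)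
  rw [show u - Ω + 2 * Ω = u + Ω by ring, sub_add_cancel] at this
  rw [this, show u - Ω = -(Ω - u) by ring, sigma_neg]
  ring

theorem xi_sq (L : PeriodPair) {Ω u : ℂ} (h : Ω ∉ L.lattice) (h2 : 2 * Ω ∈ L.lattice)
    (hu : u ∉ L.lattice) : xi L Ω u ^ 2 = L.weierstrassP u - L.weierstrassP Ω := by
  have h3 := sigma_mul_sigma L hu h
  rw [← neg_sub, ← h3, sigma_add_half L h h2, show u - Ω = -(Ω - u) by ring, sigma_neg, xi,
    sigmaHalf, show 2 * zeta L Ω * u = zeta L Ω * u + zeta L Ω * u by ring, Complex.exp_add]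
  have := sigma_ne_zero L h
  have := sigma_ne_zero L hu
  field_simp

theorem xi_neg (L : PeriodPair) {Ω : ℂ} (h : Ω ∉ L.lattice) (h2 : 2 * Ω ∈ L.lattice) (u : ℂ) :
    xi L Ω (-u) = -xi L Ω u := by
  have he := Complex.exp_ne_zero (zeta L Ω * u)
  rw [xi, xi, sigmaHalf, sigmaHalf, sub_neg_eq_add, add_comm Ω u, sigma_add_half L h h2,
    sigma_neg, show 2 * zeta L Ω * u = zeta L Ω * u + zeta L Ω * u by ring, Complex.exp_add,
    mul_neg, Complex.exp_neg]
  field_simp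

/-- The multiplier is left as an exponential. Its value is found in `xi_add_of_ne` by evaluation at
one point, so the Legendre relation is not needed. -/
theorem xi_add_half (L : PeriodPair) {Ω Ω' : ℂ} (h' : Ω' ∉ L.lattice)
    (h2' : 2 * Ω' ∈ L.lattice) {u : ℂ} (hu : u ∉ L.lattice) :
    xi L Ω (u + 2 * Ω') =
      Complex.exp (2 * zeta L Ω * Ω' - 2 * zeta L Ω' * Ω) * xi L Ω u := by
  have e1 := sigma_add_two_mul L h' h2' (Ω - (u + 2 * Ω'))
  rw [show Ω - (u + 2 * Ω') + 2 * Ω' = Ω - u by ring] at e1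
  rw [xi, xi, sigmaHalf, sigmaHalf, sigma_add_two_mul L h' h2', e1]
  have hs := sigma_ne_zero L hu
  rw [show zeta L Ω * (u + 2 * Ω') = (2 * zeta L Ω * Ω' - 2 * zeta L Ω' * Ω) + zeta L Ω * u +
    (2 * zeta L Ω' * (Ω - (u + 2 * Ω') + Ω') + 2 * zeta L Ω' * (u + Ω')) by ring,
    Complex.exp_add, Complex.exp_add, Complex.exp_add (2 * zeta L Ω' * _)]
  have he := Complex.exp_ne_zero (2 * zeta L Ω' * (u + Ω'))
  field_simp

/-- `Ω` consists of the half-periods of the lattice of the curve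
`w² = 4 (z - ℘ Ω₁) (z - ℘ Ω₂) (z - ℘ Ω₃)`. -/
structure HalfPeriods (L : PeriodPair) (Ω : Fin 3 → ℂ) : Prop where
  notMem : ∀ α, Ω α ∉ L.lattice
  two_mul_mem : ∀ α, 2 * Ω α ∈ L.lattice
  span_eq : L.lattice = Submodule.span ℤ {2 * Ω 0, 2 * Ω 2}
  ne : ∀ α β, α ≠ β → L.weierstrassP (Ω α) ≠ L.weierstrassP (Ω β)
  deriv_sq : ∀ u ∉ L.lattice, L.derivWeierstrassP u ^ 2 =
    4 * ((L.weierstrassP u - L.weierstrassP (Ω 0)) * (L.weierstrassP u - L.weierstrassP (Ω 1)) *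
      (L.weierstrassP u - L.weierstrassP (Ω 2)))

namespace HalfPeriods

variable {L : PeriodPair} {Ω : Fin 3 → ℂ}

theorem xi_sq (h : HalfPeriods L Ω) (α : Fin 3) {u : ℂ} (hu : u ∉ L.lattice) :
    xi L (Ω α) u ^ 2 = L.weierstrassP u - L.weierstrassP (Ω α) :=
  EulerPoisson.xi_sq L (h.notMem α) (h.two_mul_mem α) hu

theorem tendsto_mul_xi (h : HalfPeriods L Ω) (α : Fin 3) :
    Tendsto (fun u => u * xi L (Ω α) u) (𝓝[≠] 0) (𝓝 1) := by
  have h1 : Tendsto (fun u => sigmaHalf L (Ω α) u / sigmaProd L u) (𝓝[≠] 0) (𝓝 1) := by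
    have : ContinuousAt (fun u => sigmaHalf L (Ω α) u / sigmaProd L u) 0 :=
      ((differentiable_sigmaHalf L (Ω α)).continuous.continuousAt).div
        (differentiable_sigmaProd L).continuous.continuousAt (by simp [sigmaProd_zero])
    have h0 : sigmaHalf L (Ω α) 0 / sigmaProd L 0 = 1 := by
      simp [sigmaHalf, sigmaProd_zero, sigma_ne_zero L (h.notMem α)]
    exact (h0 ▸ this.tendsto).mono_left nhdsWithin_le_nhds
  refine h1.congr' ?_
  filter_upwards [self_mem_nhdsWithin] with u hu
  have hu : u ≠ 0 := hu
  rw [xi, sigma_eq L u]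
  field_simp

/-- Both sides have the same square, so they agree up to one global sign; the leading terms at the
origin, `2/u³` and `-(-2/u³)`, decide it. -/
theorem two_mul_xi (h : HalfPeriods L Ω) {u : ℂ} (hu : u ∉ L.lattice) :
    2 * (xi L (Ω 0) u * xi L (Ω 1) u * xi L (Ω 2) u) = -L.derivWeierstrassP u := by
  have ha : ∀ α, AnalyticOnNhd ℂ (xi L (Ω α)) (L.lattice : Set ℂ)ᶜ := fun α =>
    DifferentiableOn.analyticOnNhd
      (fun u hu => (differentiableAt_xi L (Ω α) hu).differentiableWithinAt) (isOpen_compl_lattice L)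
  have hA : AnalyticOnNhd ℂ (fun u => 2 * (xi L (Ω 0) u * xi L (Ω 1) u * xi L (Ω 2) u))
      (L.lattice : Set ℂ)ᶜ :=
    analyticOnNhd_const.mul (((ha 0).mul (ha 1)).mul (ha 2))
  have hB := L.analyticOnNhd_derivWeierstrassP
  have hprod : ∀ u ∈ (L.lattice : Set ℂ)ᶜ,
      (2 * (xi L (Ω 0) u * xi L (Ω 1) u * xi L (Ω 2) u) + L.derivWeierstrassP u) *
      (2 * (xi L (Ω 0) u * xi L (Ω 1) u * xi L (Ω 2) u) - L.derivWeierstrassP u) = 0 := by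
    intro u hu
    have e := h.deriv_sq u hu
    rw [← h.xi_sq 0 hu, ← h.xi_sq 1 hu, ← h.xi_sq 2 hu] at e
    linear_combination -e
  rcases AnalyticOnNhd.eq_zero_or_eq_zero_of_mul_eq_zero (hA.add hB) (hA.sub hB)
    hprod (isPreconnected_compl_lattice L) with h1 | h1
  · exact eq_neg_of_add_eq_zero_left (h1 u hu)
  · exfalso
    have t1 : Tendsto (fun u => 2 * ((u * xi L (Ω 0) u) * (u * xi L (Ω 1) u) *
        (u * xi L (Ω 2) u))) (𝓝[≠] 0) (𝓝 (2 * (1 * 1 * 1))) :=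
      tendsto_const_nhds.mul
        (((h.tendsto_mul_xi 0).mul (h.tendsto_mul_xi 1)).mul (h.tendsto_mul_xi 2))
    have t2 : Tendsto (fun u : ℂ => u ^ 3 * L.derivWeierstrassPExcept 0 u - 2) (𝓝[≠] 0)
        (𝓝 (0 ^ 3 * L.derivWeierstrassPExcept 0 0 - 2)) := by
      have : ContinuousAt (fun u : ℂ => u ^ 3 * L.derivWeierstrassPExcept 0 u - 2) 0 := by
        have := (L.analyticAt_derivWeierstrassPExcept 0).continuousAt
        fun_prop
      exact this.tendsto.mono_left nhdsWithin_le_nhds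
    have t3 := t1.congr' (f₂ := fun u : ℂ => u ^ 3 * L.derivWeierstrassPExcept 0 u - 2) (by
      filter_upwards [self_mem_nhdsWithin, mem_nhdsWithin_of_mem_nhds
        (L.compl_lattice_sdiff_singleton_mem_nhds 0)] with u hu hu'
      have h0 : u ≠ 0 := hu
      have h2 : u ∉ L.lattice := fun h => hu' ⟨h, h0⟩
      have h3 := h1 u h2
      have h4 := L.derivWeierstrassPExcept_def 0 u
      simp only [ZeroMemClass.coe_zero, sub_zero] at h4
      simp only [Pi.sub_apply] at h3
      rw [h4, ← sub_eq_zero.1 h3]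
      field_simp
      ring)
    have := tendsto_nhds_unique t3 t2
    norm_num at this

theorem exists_xi_ne_zero (h : HalfPeriods L Ω) : ∃ u ∉ L.lattice, ∀ α, xi L (Ω α) u ≠ 0 := by
  obtain ⟨u, hu, hu'⟩ := exists_derivWeierstrassP_ne_zero L
  refine ⟨u, hu, fun α h0 => hu' ?_⟩
  have := h.two_mul_xi hu
  fin_cases α <;> simp_all

/-- The derivative of `ξ_α² = ℘ - ℘(Ω_α)` together with `two_mul_xi` is the claim multiplied by
`ξ_α`, which is not identically zero. -/
theorem hasDerivAt_xi (h : HalfPeriods L Ω) (α : Fin 3) {u : ℂ} (hu : u ∉ L.lattice) :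
    HasDerivAt (xi L (Ω α)) (-(xi L (Ω (α + 1)) u * xi L (Ω (α + 2)) u)) u := by
  have hd : ∀ u ∉ L.lattice, HasDerivAt (xi L (Ω α)) (deriv (xi L (Ω α)) u) u :=
    fun u hu => (differentiableAt_xi L (Ω α) hu).hasDerivAt
  have ha : ∀ α, AnalyticOnNhd ℂ (xi L (Ω α)) (L.lattice : Set ℂ)ᶜ := fun α =>
    DifferentiableOn.analyticOnNhd
      (fun u hu => (differentiableAt_xi L (Ω α) hu).differentiableWithinAt) (isOpen_compl_lattice L)
  have hprod : ∀ u ∈ (L.lattice : Set ℂ)ᶜ,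
      (deriv (xi L (Ω α)) u + xi L (Ω (α + 1)) u * xi L (Ω (α + 2)) u) * xi L (Ω α) u = 0 := by
    intro u hu
    have hu : u ∉ L.lattice := hu
    have e1 := (hd u hu).pow 2
    have e2 := ((hasDerivAt_weierstrassP L hu).sub_const
      (L.weierstrassP (Ω α))).congr_of_eventuallyEq (f₁ := fun u => xi L (Ω α) u ^ 2) (by
        filter_upwards [(isOpen_compl_lattice L).mem_nhds hu] with z hz
        exact h.xi_sq α hz)
    have e3 := e1.unique e2
    have e4 := h.two_mul_xi hu
    have e5 : xi L (Ω α) u * (xi L (Ω (α + 1)) u * xi L (Ω (α + 2)) u) =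
        xi L (Ω 0) u * xi L (Ω 1) u * xi L (Ω 2) u := by
      fin_cases α
      · change xi L (Ω 0) u * (xi L (Ω 1) u * xi L (Ω 2) u) = _; ring
      · change xi L (Ω 1) u * (xi L (Ω 2) u * xi L (Ω 0) u) = _; ring
      · change xi L (Ω 2) u * (xi L (Ω 0) u * xi L (Ω 1) u) = _; ring
    simp only [Nat.cast_ofNat, Nat.add_one_sub_one, pow_one] at e3
    linear_combination e3 / 2 + e4 / 2 + e5
  rcases AnalyticOnNhd.eq_zero_or_eq_zero_of_mul_eq_zero
    (((ha α).deriv).add ((ha (α + 1)).mul (ha (α + 2)))) (ha α)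
    hprod (isPreconnected_compl_lattice L) with h1 | h1
  · rw [← eq_neg_of_add_eq_zero_left (h1 u hu)]
    exact hd u hu
  · obtain ⟨v, hv, hv'⟩ := h.exists_xi_ne_zero
    exact absurd (h1 v hv) (hv' α)

theorem xi_add_self (h : HalfPeriods L Ω) (α : Fin 3) {u : ℂ} (hu : u ∉ L.lattice) :
    xi L (Ω α) (u + 2 * Ω α) = xi L (Ω α) u := by
  rw [xi_add_half L (h.notMem α) (h.two_mul_mem α) hu, sub_self, Complex.exp_zero, one_mul]

/-- The shift by `2Ω_β` takes `-Ω_β` to `Ω_β`, where the odd function `ξ_α` does not vanish; so the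
multiplier is `-1`. -/
theorem xi_add_of_ne (h : HalfPeriods L Ω) {α β : Fin 3} (hne : α ≠ β) {u : ℂ}
    (hu : u ∉ L.lattice) : xi L (Ω α) (u + 2 * Ω β) = -xi L (Ω α) u := by
  have hn : -Ω β ∉ L.lattice := fun h' => h.notMem β (by simpa using L.lattice.neg_mem h')
  have e := xi_add_half L (Ω := Ω α) (h.notMem β) (h.two_mul_mem β) hn
  rw [show -Ω β + 2 * Ω β = Ω β by ring, xi_neg L (h.notMem α) (h.two_mul_mem α)] at e
  have h0 : xi L (Ω α) (Ω β) ≠ 0 := by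
    rw [← pow_ne_zero_iff two_ne_zero, h.xi_sq α (h.notMem β), sub_ne_zero]
    exact h.ne β α hne.symm
  rw [xi_add_half L (h.notMem β) (h.two_mul_mem β) hu]
  have : Complex.exp (2 * zeta L (Ω α) * Ω β - 2 * zeta L (Ω β) * Ω α) = -1 :=
    mul_right_cancel₀ h0 (by linear_combination e)
  rw [this, neg_one_mul]

/-- Translation by a period changes the signs of an even number of the `σ_α / σ`. -/
theorem exists_xi_add (h : HalfPeriods L Ω) {w : ℂ} (hw : w ∈ L.lattice) :
    ∃ s : Fin 3 → ℂ, (∀ α, s α ^ 2 = 1) ∧ s 0 * s 1 * s 2 = 1 ∧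
      ∀ u ∉ L.lattice, ∀ α, xi L (Ω α) (u + w) = s α * xi L (Ω α) u := by
  -- The periods that act by signs form a subgroup, so it suffices to check generators of the
  -- lattice.
  let G : AddSubgroup ℂ :=
    { carrier := {w | w ∈ L.lattice ∧ ∃ s : Fin 3 → ℂ, (∀ α, s α ^ 2 = 1) ∧
        ∀ u ∉ L.lattice, ∀ α, xi L (Ω α) (u + w) = s α * xi L (Ω α) u}
      zero_mem' := ⟨L.lattice.zero_mem, 1, by simp, by simp⟩
      add_mem' := by
        rintro x y ⟨hx, s, hs, hxs⟩ ⟨hy, t, ht, hyt⟩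
        refine ⟨L.lattice.add_mem hx hy, s * t, fun α => ?_, fun u hu α => ?_⟩
        · rw [Pi.mul_apply, mul_pow, hs, ht, one_mul]
        · rw [← add_assoc, hyt _ (mt (add_mem_lattice_iff L hx).1 hu), hxs u hu, Pi.mul_apply]
          ring
      neg_mem' := by
        rintro x ⟨hx, s, hs, hxs⟩
        refine ⟨L.lattice.neg_mem hx, s, hs, fun u hu α => ?_⟩
        have := hxs (u + -x) (mt (add_mem_lattice_iff L (L.lattice.neg_mem hx)).1 hu) α
        rw [neg_add_cancel_right] at this
        rw [this, ← mul_assoc, ← sq, hs, one_mul] }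
  have hgen : ∀ β, 2 * Ω β ∈ G := by
    intro β
    refine ⟨h.two_mul_mem β, fun α => if α = β then 1 else -1, fun α => ?_, fun u hu α => ?_⟩
    · dsimp only
      split_ifs <;> norm_num
    · by_cases hab : α = β
      · simp only [hab, if_true, one_mul]
        exact h.xi_add_self β hu
      · simp only [hab, if_false, neg_one_mul]
        exact h.xi_add_of_ne hab hu
  have hle : L.lattice ≤ AddSubgroup.toIntSubmodule G := by
    rw [h.span_eq, Submodule.span_le]
    rintro x (rfl | rfl)
    · exact hgen 0
    · exact hgen 2
  obtain ⟨-, s, hs, hsu⟩ := hle hw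
  refine ⟨s, hs, ?_, hsu⟩
  -- The product of the three `ξ_α` is `-℘'/2`, which is periodic; hence the signs multiply to `1`.
  obtain ⟨u, hu, hu'⟩ := h.exists_xi_ne_zero
  have e1 := h.two_mul_xi (mt (add_mem_lattice_iff L hw).1 hu)
  rw [L.derivWeierstrassP_add_coe u ⟨w, hw⟩, ← h.two_mul_xi hu, hsu u hu, hsu u hu, hsu u hu] at e1
  refine mul_right_cancel₀ (mul_ne_zero (mul_ne_zero (hu' 0) (hu' 1)) (hu' 2)) ?_
  linear_combination e1 / 2

/-- The signs of the `σ_α / σ` can be changed arbitrarily by `u ↦ ± u + w`, with a period `w`. -/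
theorem exists_xi_eq (h : HalfPeriods L Ω) {u : ℂ} (hu : u ∉ L.lattice) (x : Fin 3 → ℂ)
    (hx : ∀ α, x α ^ 2 = L.weierstrassP u - L.weierstrassP (Ω α)) :
    ∃ v ∉ L.lattice, ∀ α, xi L (Ω α) v = x α := by
  have hpm : ∀ α, x α = xi L (Ω α) u ∨ x α = -xi L (Ω α) u := fun α =>
    sq_eq_sq_iff_eq_or_eq_neg.1 ((hx α).trans (h.xi_sq α hu).symm)
  have hneg : -u ∉ L.lattice := fun h' => hu (by simpa using L.lattice.neg_mem h')
  have hm : ∀ {u : ℂ}, u ∉ L.lattice → ∀ β, u + 2 * Ω β ∉ L.lattice := fun hu β =>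
    mt (add_mem_lattice_iff L (h.two_mul_mem β)).1 hu
  have hn : ∀ α, xi L (Ω α) (-u) = -xi L (Ω α) u := fun α =>
    xi_neg L (h.notMem α) (h.two_mul_mem α) u
  have hs : ∀ {u : ℂ}, u ∉ L.lattice → ∀ β α, xi L (Ω α) (u + 2 * Ω β) =
      if α = β then xi L (Ω α) u else -xi L (Ω α) u := by
    intro u hu β α
    split_ifs with hab
    · subst hab
      exact h.xi_add_self α hu
    · exact h.xi_add_of_ne hab hu
  -- Negation flips all three signs and a shift by `2Ω_β` flips the two with index other than `β`;
  -- the eight patterns are combinations of these.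
  rcases hpm 0 with h0 | h0 <;> rcases hpm 1 with h1 | h1 <;> rcases hpm 2 with h2 | h2
  · exact ⟨u, hu, fun α => by fin_cases α <;> simp [h0, h1, h2]⟩
  · exact ⟨-u + 2 * Ω 2, hm hneg 2, fun α => by
      rw [hs hneg, hn]; fin_cases α <;> simp [h0, h1, h2]⟩
  · exact ⟨-u + 2 * Ω 1, hm hneg 1, fun α => by
      rw [hs hneg, hn]; fin_cases α <;> simp [h0, h1, h2]⟩
  · exact ⟨u + 2 * Ω 0, hm hu 0, fun α => by
      rw [hs hu]; fin_cases α <;> simp [h0, h1, h2]⟩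
  · exact ⟨-u + 2 * Ω 0, hm hneg 0, fun α => by
      rw [hs hneg, hn]; fin_cases α <;> simp [h0, h1, h2]⟩
  · exact ⟨u + 2 * Ω 1, hm hu 1, fun α => by
      rw [hs hu]; fin_cases α <;> simp [h0, h1, h2]⟩
  · exact ⟨u + 2 * Ω 2, hm hu 2, fun α => by
      rw [hs hu]; fin_cases α <;> simp [h0, h1, h2]⟩
  · exact ⟨-u, hneg, fun α => by rw [hn]; fin_cases α <;> simp [h0, h1, h2]⟩

end HalfPeriods

/-! ### Uniqueness along curves and inversion of the Abel integral -/

/-- A curve that satisfies the same autonomous equation, with respect to the complex time `θ`, as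
a curve `G` with the poles of `℘` only, and meets it, stays on it. -/
theorem eq_of_flow {E : Type*} [NormedAddCommGroup E] [NormedSpace ℝ E] [NormedSpace ℂ E]
    [IsScalarTower ℝ ℂ E] (L : PeriodPair) {V : E → E} (hV : ContDiff ℂ 1 V) {G : ℂ → E}
    (hG : ∀ u ∉ L.lattice, HasDerivAt G (V (G u)) u) {Ψ : E → ℂ} (hΨ : Continuous Ψ)
    (hGΨ : ∀ u ∉ L.lattice, Ψ (G u) = L.weierstrassP u) {I : Set ℝ} (hI : IsOpen I)
    (hIc : IsPreconnected I) {f : ℝ → E} {θ θ' : ℝ → ℂ} (hθ : ∀ t ∈ I, HasDerivAt θ (θ' t) t)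
    (hθ' : ContinuousOn θ' I) (hf : ∀ t ∈ I, HasDerivAt f (θ' t • V (f t)) t) {t₀ : ℝ}
    (ht₀ : t₀ ∈ I) (h₀ : θ t₀ ∉ L.lattice) (hft₀ : f t₀ = G (θ t₀)) :
    ∀ t ∈ I, θ t ∉ L.lattice ∧ f t = G (θ t) := by
  set S : Set ℝ := {t | t ∈ I ∧ θ t ∉ L.lattice ∧ f t = G (θ t)} with hS
  have hSo : IsOpen S := by
    rw [isOpen_iff_mem_nhds]
    rintro t₁ ⟨ht₁, hl, hft⟩
    obtain ⟨K, B, hB, hK⟩ := (hV.contDiffAt (x := f t₁)).exists_lipschitzOnWith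
    have hIn := hI.mem_nhds ht₁
    have hθc : ContinuousAt θ t₁ := (hθ t₁ ht₁).continuousAt
    have hln : ∀ᶠ t in 𝓝 t₁, θ t ∉ L.lattice :=
      hθc.eventually ((isOpen_compl_lattice L).mem_nhds hl)
    have hGc : ContinuousAt (fun t => G (θ t)) t₁ :=
      ContinuousAt.comp (f := θ) (hG _ hl).continuousAt hθc
    have hC : ∀ᶠ t in 𝓝 t₁, ‖θ' t‖ < ‖θ' t₁‖ + 1 :=
      (hθ'.continuousAt hIn).norm.eventually (gt_mem_nhds (lt_add_one _))
    have huniq := ODE_solution_unique_of_eventually (v := fun t x => θ' t • V x)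
      (s := fun _ => B) (K := (‖θ' t₁‖₊ + 1) * K) (f := f) (g := fun t => G (θ t)) (t₀ := t₁)
      ?_ ?_ ?_ hft
    · filter_upwards [huniq, hIn, hln] with t h1 h2 h3 using ⟨h2, h3, h1⟩
    · filter_upwards [hC] with t ht
      rw [lipschitzOnWith_iff_norm_sub_le] at hK ⊢
      intro x hx y hy
      rw [← smul_sub, norm_smul]
      have := hK hx hy
      push_cast
      rw [mul_assoc]
      exact mul_le_mul ht.le this (norm_nonneg _) (by positivity)
    · filter_upwards [hIn, (hf t₁ ht₁).continuousAt.eventually hB] with t h1 h2 using ⟨hf t h1, h2⟩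
    · filter_upwards [hIn, hln, hGc.eventually (show B ∈ 𝓝 (G (θ t₁)) from hft ▸ hB)] with t h1 h2 h3
      exact ⟨(hG _ h2).scomp t (hθ t h1), h3⟩
  have hcl : closure S ∩ I ⊆ S := by
    rintro t₁ ⟨hc, ht₁⟩
    have hne : (𝓝[S] t₁).NeBot := mem_closure_iff_nhdsWithin_neBot.1 hc
    have hθt : Tendsto θ (𝓝[S] t₁) (𝓝 (θ t₁)) :=
      (hθ t₁ ht₁).continuousAt.tendsto.mono_left nhdsWithin_le_nhds
    have hft : Tendsto f (𝓝[S] t₁) (𝓝 (f t₁)) :=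
      (hf t₁ ht₁).continuousAt.tendsto.mono_left nhdsWithin_le_nhds
    -- If `θ` ran into a pole at `t₁`, then `℘(θ(t))` would tend to infinity, while it equals
    -- `Ψ(f(t))`, which stays bounded near `t₁`.
    have hl : θ t₁ ∉ L.lattice := by
      intro hl
      have h1 : Tendsto θ (𝓝[S] t₁) (𝓝[≠] (θ t₁)) := by
        refine tendsto_nhdsWithin_iff.2 ⟨hθt, ?_⟩
        filter_upwards [self_mem_nhdsWithin] with t ht heq
        exact ht.2.1 (heq ▸ hl)
      have h2 := (tendsto_weierstrassP_cobounded L hl).comp h1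
      have h3 : Tendsto (fun t => Ψ (f t)) (𝓝[S] t₁) (𝓝 (Ψ (f t₁))) :=
        (hΨ.tendsto _).comp hft
      refine not_tendsto_atTop_of_tendsto_nhds h3.norm
        ((tendsto_norm_cobounded_atTop.comp h2).congr' ?_)
      filter_upwards [self_mem_nhdsWithin] with t ht
      simp only [Function.comp]
      rw [ht.2.2, hGΨ _ ht.2.1]
    refine ⟨ht₁, hl, tendsto_nhds_unique hft ?_⟩
    refine (((hG _ hl).continuousAt.tendsto).comp hθt).congr' ?_
    filter_upwards [self_mem_nhdsWithin] with t ht using ht.2.2.symm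
  have := hIc.subset_of_closure_inter_subset hSo ⟨t₀, ht₀, ht₀, h₀, hft₀⟩ hcl
  exact fun t ht => (this ht).2

/-- A continuous branch of a square root away from zero: the slope of `w` is the slope of `q`
divided by `w(τ) + w(t)`. Differentiability of the chosen root of `U₄` along a path is obtained this
way. -/
theorem hasDerivAt_of_sq {w q : ℝ → ℂ} {q' : ℂ} {t : ℝ} (hw : ContinuousAt w t)
    (hq : HasDerivAt q q' t) (h : ∀ᶠ τ in 𝓝 t, w τ ^ 2 = q τ) (h0 : w t ≠ 0) :
    HasDerivAt w (q' / (2 * w t)) t := by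
  rw [hasDerivAt_iff_tendsto_slope] at hq ⊢
  have h2 : w t + w t ≠ 0 := by rw [← two_mul]; exact mul_ne_zero two_ne_zero h0
  have hc : Tendsto (fun τ => w τ + w t) (𝓝[≠] t) (𝓝 (w t + w t)) :=
    (hw.tendsto.add_const _).mono_left nhdsWithin_le_nhds
  have := hq.div hc h2
  rw [← two_mul] at this
  refine this.congr' ?_
  have hne := hc.eventually_ne h2
  filter_upwards [hne, mem_nhdsWithin_of_mem_nhds h] with τ h3 h4
  simp only [Pi.div_apply, slope_def_module, Complex.real_smul]
  rw [div_eq_iff h3, ← h4, ← h.self_of_nhds]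
  ring

/-- The coordinate of the Weierstrass form that belongs to a point of the quartic `U4`. -/
noncomputable def wpt (a : Fin 3 → ℂ) (c : ℂ) : OnePoint ℂ → ℂ
  | some x => e a c 0 + (x - a 0) * ((a 1 - c) * (a 2 - c)) / (x - c)
  | none => e a c 0 + (a 1 - c) * (a 2 - c)

theorem wpt_coe (a : Fin 3 → ℂ) (c x : ℂ) :
    wpt a c (x : OnePoint ℂ) = e a c 0 + (x - a 0) * ((a 1 - c) * (a 2 - c)) / (x - c) := rfl

theorem wpt_infty (a : Fin 3 → ℂ) (c : ℂ) :
    wpt a c OnePoint.infty = e a c 0 + (a 1 - c) * (a 2 - c) := rfl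

theorem e_zero (a : Fin 3 → ℂ) (c : ℂ) : e a c 0 =
    ((a 0 * a 1 + a 1 * a 2 + a 2 * a 0) + c * (a 0 + a 1 + a 2) - 3 * (a 1 * a 2 + c * a 0)) / 3 :=
  rfl

theorem e_one (a : Fin 3 → ℂ) (c : ℂ) : e a c 1 =
    ((a 0 * a 1 + a 1 * a 2 + a 2 * a 0) + c * (a 0 + a 1 + a 2) - 3 * (a 2 * a 0 + c * a 1)) / 3 :=
  rfl

theorem e_two (a : Fin 3 → ℂ) (c : ℂ) : e a c 2 =
    ((a 0 * a 1 + a 1 * a 2 + a 2 * a 0) + c * (a 0 + a 1 + a 2) - 3 * (a 0 * a 1 + c * a 2)) / 3 :=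
  rfl

theorem e_sum (a : Fin 3 → ℂ) (c : ℂ) : e a c 0 + e a c 1 + e a c 2 = 0 := by
  rw [e_zero, e_one, e_two]; ring

theorem wpt_eq (a : Fin 3 → ℂ) (c x : ℂ) (hx : x ≠ c) : wpt a c (x : OnePoint ℂ) =
    wpt a c OnePoint.infty - (a 0 - c) * (a 1 - c) * (a 2 - c) / (x - c) := by
  have : x - c ≠ 0 := sub_ne_zero.2 hx
  rw [wpt_coe, wpt_infty]
  field_simp
  ring

theorem wpt_sub_e (a : Fin 3 → ℂ) (c x : ℂ) (hx : x ≠ c) (α : Fin 3) :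
    wpt a c (x : OnePoint ℂ) - e a c α =
      (x - a α) * ((a (α + 1) - c) * (a (α + 2) - c)) / (x - c) := by
  have : x - c ≠ 0 := sub_ne_zero.2 hx
  rw [wpt_coe]
  fin_cases α
  · change _ - e a c 0 = (x - a 0) * ((a 1 - c) * (a 2 - c)) / (x - c)
    ring
  · change _ - e a c 1 = (x - a 1) * ((a 2 - c) * (a 0 - c)) / (x - c)
    rw [e_zero, e_one]
    field_simp
    ring
  · change _ - e a c 2 = (x - a 2) * ((a 0 - c) * (a 1 - c)) / (x - c)
    rw [e_zero, e_two]
    field_simp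
    ring

theorem wpt_branch {a : Fin 3 → ℂ} {c : ℂ} (hca : ∀ α, c ≠ a α) (α : Fin 3) :
    wpt a c (a α : OnePoint ℂ) = e a c α := by
  have := wpt_sub_e a c (a α) (hca α).symm α
  rwa [sub_self, zero_mul, zero_div, sub_eq_zero] at this

/-- The Abel integral is inverted by `℘`. -/
theorem weierstrassP_of_isAbelIntegral {a : Fin 3 → ℂ} {c : ℂ} (hca : ∀ α, c ≠ a α)
    (L : PeriodPair) (hg₂ : L.g₂ = -4 * (e a c 0 * e a c 1 + e a c 1 * e a c 2 + e a c 2 * e a c 0))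
    (hg₃ : L.g₃ = 4 * (e a c 0 * e a c 1 * e a c 2)) {p : OnePoint ℂ} {u : ℂ}
    (hp : p ≠ (c : OnePoint ℂ)) (h : IsAbelIntegral a c p u) :
    u ∉ L.lattice ∧ L.weierstrassP u = wpt a c p := by
  obtain ⟨x, x', y, hx, hx'c, hyc, hy, hxc, hxp, hint, rfl⟩ := h
  set φ : ℝ → ℂ := fun t => Complex.I * x' t / (2 * y t) with hφ
  have hφc : ContinuousOn φ (Ioo 0 1) := (continuousOn_const.mul hx'c).div
    (continuousOn_const.mul hyc) fun t ht => mul_ne_zero two_ne_zero (hy t ht).2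
  set U : ℝ → ℂ := fun t => ∫ τ in (0 : ℝ)..t, φ τ with hU
  have hUd : ∀ t ∈ Ioo (0 : ℝ) 1, HasDerivAt U (φ t) t := by
    intro t ht
    refine intervalIntegral.integral_hasDerivAt_right
      (hint.mono_set ?_) ?_ (hφc.continuousAt (isOpen_Ioo.mem_nhds ht))
    · rw [uIcc_of_le ht.1.le, uIcc_of_le zero_le_one]
      exact Icc_subset_Icc_right ht.2.le
    · exact hφc.stronglyMeasurableAtFilter isOpen_Ioo t ht
  have hUc : ContinuousOn U (Icc 0 1) := by
    have := intervalIntegral.continuousOn_primitive_interval (μ := MeasureTheory.volume)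
      (f := φ) (a := 0) (b := 1) (by
        rw [← intervalIntegrable_iff']
        exact hint)
    rwa [uIcc_of_le zero_le_one] at this
  have hxne : ∀ t ∈ Ioo (0 : ℝ) 1, x t ≠ c := by
    intro t ht h0
    have := (hy t ht).1
    rw [h0] at this
    simp [U4, (hy t ht).2] at this
  set B : ℂ := (a 0 - c) * (a 1 - c) * (a 2 - c) with hB
  have hB0 : B ≠ 0 := mul_ne_zero (mul_ne_zero (sub_ne_zero.2 (hca 0).symm)
    (sub_ne_zero.2 (hca 1).symm)) (sub_ne_zero.2 (hca 2).symm)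
  -- The path transported to the Weierstrass curve; the factor in `w` is forced by `dz/dt = φ w`.
  -- Then `(z, w)` obeys, in the time `U`, the same system as `(℘, ℘')`.
  set z : ℝ → ℂ := fun t => wpt a c OnePoint.infty - B * (x t - c)⁻¹ with hz
  set w : ℝ → ℂ := fun t => -2 * Complex.I * B * y t * ((x t - c)⁻¹) ^ 2 with hw
  have hzx : ∀ t ∈ Ioo (0 : ℝ) 1, z t = wpt a c (x t : OnePoint ℂ) := fun t ht => by
    rw [wpt_eq a c _ (hxne t ht), div_eq_mul_inv]
  have hzd : ∀ t ∈ Ioo (0 : ℝ) 1, HasDerivAt z (φ t * w t) t := by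
    intro t ht
    have hn : x t - c ≠ 0 := sub_ne_zero.2 (hxne t ht)
    have hyn := (hy t ht).2
    have := ((((hx t ht).sub_const c).inv hn).const_mul B).const_sub (wpt a c OnePoint.infty)
    convert! this using 1
    simp only [hφ, hw]
    field_simp
    rw [Complex.I_sq]
    ring
  have hg : ∀ z : ℂ, 4 * z ^ 3 - L.g₂ * z - L.g₃ =
      4 * ((z - e a c 0) * (z - e a c 1) * (z - e a c 2)) := by
    intro z
    rw [hg₂, hg₃]
    linear_combination 4 * z ^ 2 * e_sum a c
  have hw2 : ∀ t ∈ Ioo (0 : ℝ) 1, w t ^ 2 = 4 * z t ^ 3 - L.g₂ * z t - L.g₃ := by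
    intro t ht
    have hn : x t - c ≠ 0 := sub_ne_zero.2 (hxne t ht)
    rw [hg, hzx t ht, wpt_sub_e _ _ _ (hxne t ht), wpt_sub_e _ _ _ (hxne t ht),
      wpt_sub_e _ _ _ (hxne t ht)]
    simp only [hw, mul_pow, (hy t ht).1, Complex.I_sq, U4]
    change _ = 4 * ((x t - a 0) * ((a 1 - c) * (a 2 - c)) / (x t - c) *
      ((x t - a 1) * ((a 2 - c) * (a 0 - c)) / (x t - c)) *
      ((x t - a 2) * ((a 0 - c) * (a 1 - c)) / (x t - c)))
    rw [hB]
    field_simp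
    ring
  have hwne : ∀ t ∈ Ioo (0 : ℝ) 1, w t ≠ 0 := by
    intro t ht
    have hn : x t - c ≠ 0 := sub_ne_zero.2 (hxne t ht)
    simp [hw, hB0, (hy t ht).2, hn, Complex.I_ne_zero]
  have hwdiff : ∀ t ∈ Ioo (0 : ℝ) 1, HasDerivAt w (φ t * (6 * z t ^ 2 - L.g₂ / 2)) t := by
    intro t ht
    have hn : x t - c ≠ 0 := sub_ne_zero.2 (hxne t ht)
    have hIt := isOpen_Ioo.mem_nhds ht
    have hwc : ContinuousAt w t := by
      have h1 := hyc.continuousAt hIt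
      have h2 := (((hx t ht).continuousAt.sub (continuousAt_const (y := c))).inv₀ hn).pow 2
      exact (continuousAt_const.mul h1).mul h2
    have h1 := hzd t ht
    have h2 := hasDerivAt_of_sq hwc ((((h1.pow 3).const_mul 4).sub (h1.const_mul L.g₂)).sub_const
      L.g₃) (by filter_upwards [hIt] with τ hτ using hw2 τ hτ) (hwne t ht)
    convert! h2 using 1
    have := hwne t ht
    field_simp
    push_cast
    ring
  have hhalf : (1 / 2 : ℝ) ∈ Ioo (0 : ℝ) 1 := by norm_num
  obtain ⟨u₀, hu₀, hzu, hwu⟩ : ∃ u₀ ∉ L.lattice, L.weierstrassP u₀ = z (1 / 2) ∧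
      L.derivWeierstrassP u₀ = w (1 / 2) := by
    obtain ⟨u₀, hu₀, hzu⟩ := exists_weierstrassP_eq L (z (1 / 2))
    have := L.derivWeierstrassP_sq u₀ hu₀
    rw [hzu, ← hw2 _ hhalf] at this
    rcases sq_eq_sq_iff_eq_or_eq_neg.1 this with h | h
    · exact ⟨u₀, hu₀, hzu, h⟩
    · exact ⟨-u₀, fun h' => hu₀ (by simpa using L.lattice.neg_mem h'), by simpa using hzu,
        by rw [L.derivWeierstrassP_neg, h, neg_neg]⟩
  -- The comparison starts at an interior time because the endpoints may be singular; so `(z, w) =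
  -- (℘, ℘')(U + d)` with a shift `d` still to be identified.
  set d : ℂ := u₀ - U (1 / 2) with hd
  have key := eq_of_flow (E := ℂ × ℂ) L (V := fun q => (q.2, 6 * q.1 ^ 2 - L.g₂ / 2))
    (by fun_prop) (G := fun u => (L.weierstrassP u, L.derivWeierstrassP u))
    (fun u hu => (hasDerivAt_weierstrassP L hu).prodMk (hasDerivAt_derivWeierstrassP L hu))
    (Ψ := Prod.fst) continuous_fst (fun _ _ => rfl) (I := Ioo 0 1) isOpen_Ioo
    isPreconnected_Ioo (f := fun t => (z t, w t)) (θ := fun t => U t + d) (θ' := φ)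
    (fun t ht => (hUd t ht).add_const d) hφc
    (fun t ht => (hzd t ht).prodMk (hwdiff t ht)) hhalf
    (by simpa [hd] using hu₀) (by simp [hd, hzu, hwu])
  have hU0 : Tendsto U (𝓝[>] 0) (𝓝 0) := by
    have h1 := (hUc 0 (by simp)).tendsto
    rw [show U 0 = 0 by simp [hU]] at h1
    rw [← nhdsWithin_Ioo_eq_nhdsGT zero_lt_one]
    exact h1.mono_left (nhdsWithin_mono _ Ioo_subset_Icc_self)
  have hU1 : Tendsto U (𝓝[<] 1) (𝓝 (U 1)) := by
    have h1 := (hUc 1 (by simp)).tendsto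
    rw [← nhdsWithin_Ioo_eq_nhdsLT zero_lt_one]
    exact h1.mono_left (nhdsWithin_mono _ Ioo_subset_Icc_self)
  have ev0 : ∀ᶠ t in 𝓝[>] (0 : ℝ), t ∈ Ioo (0 : ℝ) 1 := Ioo_mem_nhdsGT zero_lt_one
  have ev1 : ∀ᶠ t in 𝓝[<] (1 : ℝ), t ∈ Ioo (0 : ℝ) 1 := Ioo_mem_nhdsLT zero_lt_one
  -- As `t → 0` the path tends to `c`, so `z` tends to infinity while `U` tends to `0`; thus `d` is
  -- a pole of `℘`.
  have hdl : d ∈ L.lattice := by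
    by_contra hdl
    have h1 : Tendsto (fun t => L.weierstrassP (U t + d)) (𝓝[>] 0) (𝓝 (L.weierstrassP d)) := by
      have := (hasDerivAt_weierstrassP L hdl).continuousAt.tendsto
      refine this.comp ?_
      simpa using hU0.add_const d
    have h2 : Tendsto (fun t => x t - c) (𝓝[>] 0) (𝓝[≠] 0) := by
      refine tendsto_nhdsWithin_iff.2 ⟨by simpa using hxc.sub_const c, ?_⟩
      filter_upwards [ev0] with t ht using sub_ne_zero.2 (hxne t ht)
    have h3 := tendsto_inv₀_nhdsNE_zero.comp h2
    have h4 : Tendsto (fun t => B⁻¹ * (wpt a c OnePoint.infty - L.weierstrassP (U t + d)))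
        (𝓝[>] 0) (𝓝 (B⁻¹ * (wpt a c OnePoint.infty - L.weierstrassP d))) :=
      (h1.const_sub _).const_mul _
    refine not_tendsto_atTop_of_tendsto_nhds h4.norm
      ((tendsto_norm_cobounded_atTop.comp h3).congr' ?_)
    filter_upwards [ev0] with t ht
    have := congrArg Prod.fst (key t ht).2
    simp only at this
    simp only [Function.comp, ← this, hz, sub_sub_cancel]
    rw [inv_mul_cancel_left₀ hB0]
  have hzU : ∀ t ∈ Ioo (0 : ℝ) 1, U t ∉ L.lattice ∧ z t = L.weierstrassP (U t) := by
    intro t ht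
    have h1 := (key t ht).1
    have h2 := congrArg Prod.fst (key t ht).2
    simp only at h2
    exact ⟨mt (add_mem_lattice_iff L hdl).2 h1, h2.trans (weierstrassP_add L _ hdl)⟩
  have hz1 : Tendsto z (𝓝[<] 1) (𝓝 (wpt a c p)) := by
    induction p using OnePoint.rec with
    | infty =>
      have h1 : Tendsto x (𝓝[<] 1) (cocompact ℂ) := by
        rw [← coclosedCompact_eq_cocompact, ← OnePoint.comap_coe_nhds_infty, tendsto_comap_iff]
        exact hxp
      have h2 : Tendsto (fun t => x t - c) (𝓝[<] 1) (Bornology.cobounded ℂ) := by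
        rw [← Metric.cobounded_eq_cocompact] at h1
        simpa only [sub_eq_add_neg] using! (tendsto_add_const_cobounded (-c)).comp h1
      have h3 := tendsto_inv₀_cobounded.comp h2
      simpa using! (h3.const_mul B).const_sub (wpt a c OnePoint.infty)
    | coe q =>
      have h1 : Tendsto x (𝓝[<] 1) (𝓝 q) := OnePoint.isOpenEmbedding_coe.tendsto_nhds_iff.2 hxp
      have hq : q ≠ c := fun h => hp (by rw [h])
      rw [wpt_eq a c q hq, div_eq_mul_inv]
      exact (((h1.sub_const c).inv₀ (sub_ne_zero.2 hq)).const_mul B).const_sub _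
  -- The end point `p` differs from `c`, so `z` has a finite limit there.
  have hl : U 1 ∉ L.lattice := by
    intro hl
    have h1 : Tendsto U (𝓝[<] 1) (𝓝[≠] (U 1)) := by
      refine tendsto_nhdsWithin_iff.2 ⟨hU1, ?_⟩
      filter_upwards [ev1] with t ht heq
      exact (hzU t ht).1 (heq ▸ hl)
    refine not_tendsto_atTop_of_tendsto_nhds hz1.norm
      ((tendsto_norm_cobounded_atTop.comp
        ((tendsto_weierstrassP_cobounded L hl).comp h1)).congr' ?_)
    filter_upwards [ev1] with t ht
    simp only [Function.comp, (hzU t ht).2]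
  refine ⟨hl, tendsto_nhds_unique ?_ hz1⟩
  refine ((hasDerivAt_weierstrassP L hl).continuousAt.tendsto.comp hU1).congr' ?_
  filter_upwards [ev1] with t ht using (hzU t ht).2.symm

/-! ### Identities for the `ε_α²` and `e_α`, and the matrices `A_n` -/

/-- The number `ε_α²`. -/
noncomputable def epsSq (a : Fin 3 → ℂ) (α : Fin 3) : ℂ :=
  1 / ((a α - a (α + 1)) * (a α - a (α + 2)))

/-- The discriminant factor `(a₁ - a₂)(a₂ - a₃)(a₃ - a₁)`. -/
noncomputable def vand (a : Fin 3 → ℂ) : ℂ := (a 0 - a 1) * (a 1 - a 2) * (a 2 - a 0)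

theorem epsSq_zero (a : Fin 3 → ℂ) : epsSq a 0 = 1 / ((a 0 - a 1) * (a 0 - a 2)) := rfl
theorem epsSq_one (a : Fin 3 → ℂ) : epsSq a 1 = 1 / ((a 1 - a 2) * (a 1 - a 0)) := rfl
theorem epsSq_two (a : Fin 3 → ℂ) : epsSq a 2 = 1 / ((a 2 - a 0) * (a 2 - a 1)) := rfl

theorem sub_ne_zero_of_injective {a : Fin 3 → ℂ} (ha : Function.Injective a) {α β : Fin 3}
    (h : α ≠ β) : a α - a β ≠ 0 := sub_ne_zero.2 (ha.ne h)

theorem vand_ne_zero {a : Fin 3 → ℂ} (ha : Function.Injective a) : vand a ≠ 0 :=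
  mul_ne_zero (mul_ne_zero (sub_ne_zero_of_injective ha (by decide))
    (sub_ne_zero_of_injective ha (by decide))) (sub_ne_zero_of_injective ha (by decide))

theorem epsSq_ne_zero {a : Fin 3 → ℂ} (ha : Function.Injective a) (α : Fin 3) : epsSq a α ≠ 0 := by
  refine one_div_ne_zero (mul_ne_zero (sub_ne_zero_of_injective ha ?_)
    (sub_ne_zero_of_injective ha ?_)) <;> revert α <;> decide

/-- This and the next three identities are cases of Lagrange interpolation at the nodes `a_α`: the
sums of `a_α^j ε_α²` are `0, 0, 1` for `j = 0, 1, 2`. They are the coefficients of the two quadratic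
integrals after the substitution of `z`. -/
theorem epsSq_sum {a : Fin 3 → ℂ} (ha : Function.Injective a) :
    epsSq a 0 + epsSq a 1 + epsSq a 2 = 0 := by
  have h01 := sub_ne_zero_of_injective ha (show (0 : Fin 3) ≠ 1 by decide)
  have h12 := sub_ne_zero_of_injective ha (show (1 : Fin 3) ≠ 2 by decide)
  have h02 := sub_ne_zero_of_injective ha (show (0 : Fin 3) ≠ 2 by decide)
  rw [epsSq_zero, epsSq_one, epsSq_two, show a 1 - a 0 = -(a 0 - a 1) by ring,
    show a 2 - a 0 = -(a 0 - a 2) by ring, show a 2 - a 1 = -(a 1 - a 2) by ring]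
  field_simp
  ring

theorem epsSq_sum_mul {a : Fin 3 → ℂ} (ha : Function.Injective a) :
    a 0 * epsSq a 0 + a 1 * epsSq a 1 + a 2 * epsSq a 2 = 0 := by
  have h01 := sub_ne_zero_of_injective ha (show (0 : Fin 3) ≠ 1 by decide)
  have h12 := sub_ne_zero_of_injective ha (show (1 : Fin 3) ≠ 2 by decide)
  have h02 := sub_ne_zero_of_injective ha (show (0 : Fin 3) ≠ 2 by decide)
  rw [epsSq_zero, epsSq_one, epsSq_two, show a 1 - a 0 = -(a 0 - a 1) by ring,
    show a 2 - a 0 = -(a 0 - a 2) by ring, show a 2 - a 1 = -(a 1 - a 2) by ring]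
  field_simp
  ring

theorem epsSq_sum_e {a : Fin 3 → ℂ} (ha : Function.Injective a) (c : ℂ) :
    epsSq a 0 * e a c 0 + epsSq a 1 * e a c 1 + epsSq a 2 * e a c 2 = -1 := by
  have h01 := sub_ne_zero_of_injective ha (show (0 : Fin 3) ≠ 1 by decide)
  have h12 := sub_ne_zero_of_injective ha (show (1 : Fin 3) ≠ 2 by decide)
  have h02 := sub_ne_zero_of_injective ha (show (0 : Fin 3) ≠ 2 by decide)
  rw [epsSq_zero, epsSq_one, epsSq_two, show a 1 - a 0 = -(a 0 - a 1) by ring,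
    show a 2 - a 0 = -(a 0 - a 2) by ring, show a 2 - a 1 = -(a 1 - a 2) by ring,
    e_zero, e_one, e_two]
  field_simp
  ring

theorem epsSq_sum_mul_e {a : Fin 3 → ℂ} (ha : Function.Injective a) (c : ℂ) :
    a 0 * epsSq a 0 * e a c 0 + a 1 * epsSq a 1 * e a c 1 + a 2 * epsSq a 2 * e a c 2 = -c := by
  have h01 := sub_ne_zero_of_injective ha (show (0 : Fin 3) ≠ 1 by decide)
  have h12 := sub_ne_zero_of_injective ha (show (1 : Fin 3) ≠ 2 by decide)
  have h02 := sub_ne_zero_of_injective ha (show (0 : Fin 3) ≠ 2 by decide)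
  rw [epsSq_zero, epsSq_one, epsSq_two, show a 1 - a 0 = -(a 0 - a 1) by ring,
    show a 2 - a 0 = -(a 0 - a 2) by ring, show a 2 - a 1 = -(a 1 - a 2) by ring,
    e_zero, e_one, e_two]
  field_simp
  ring

theorem e_sub_e (a : Fin 3 → ℂ) (c : ℂ) :
    e a c 0 - e a c 1 = (a 0 - a 1) * (a 2 - c) ∧ e a c 1 - e a c 2 = (a 1 - a 2) * (a 0 - c) ∧
      e a c 0 - e a c 2 = (a 0 - a 2) * (a 1 - c) := by
  rw [e_zero, e_one, e_two]
  refine ⟨?_, ?_, ?_⟩ <;> ring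

theorem e_injective {a : Fin 3 → ℂ} (ha : Function.Injective a) {c : ℂ} (hca : ∀ α, c ≠ a α)
    {α β : Fin 3} (h : α ≠ β) : e a c α ≠ e a c β := by
  obtain ⟨h1, h2, h3⟩ := e_sub_e a c
  have n : ∀ {α β γ : Fin 3}, α ≠ β → (a α - a β) * (a γ - c) ≠ 0 := fun h =>
    mul_ne_zero (sub_ne_zero_of_injective ha h) (sub_ne_zero.2 (hca _).symm)
  have h01 : e a c 0 ≠ e a c 1 := sub_ne_zero.1 (h1 ▸ n (by decide))
  have h12 : e a c 1 ≠ e a c 2 := sub_ne_zero.1 (h2 ▸ n (by decide))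
  have h02 : e a c 0 ≠ e a c 2 := sub_ne_zero.1 (h3 ▸ n (by decide))
  fin_cases α <;> fin_cases β
  · exact absurd rfl h
  · exact h01
  · exact h02
  · exact h01.symm
  · exact absurd rfl h
  · exact h12
  · exact h02.symm
  · exact h12.symm
  · exact absurd rfl h

/-- The two integrals are linear in the squares. Once `z` is fixed by the first component, the
errors in the other two satisfy a homogeneous system with determinant of modulus `|a₂ - a₃|`. -/
theorem exists_sq_eq {a : Fin 3 → ℂ} (ha : Function.Injective a) {l m c : ℂ} (hm : m ≠ 0)
    (hc : c = l / m ^ 2) {M : Fin 3 → ℂ} (h1 : M ⬝ᵥ (a * M) = l) (h2 : M ⬝ᵥ M = m ^ 2) :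
    ∃ z, ∀ α, M α ^ 2 = m ^ 2 * epsSq a α * (z - e a c α) := by
  have hE := epsSq_ne_zero ha 0
  have hl : l = c * m ^ 2 := by rw [hc]; field_simp
  refine ⟨M 0 ^ 2 / (m ^ 2 * epsSq a 0) + e a c 0, ?_⟩
  set z := M 0 ^ 2 / (m ^ 2 * epsSq a 0) + e a c 0 with hz
  have e0 : M 0 ^ 2 = m ^ 2 * epsSq a 0 * (z - e a c 0) := by
    rw [hz]; field_simp; ring
  simp only [dotProduct, Fin.sum_univ_three, Pi.mul_apply] at h1 h2
  have s1 := epsSq_sum ha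
  have s2 := epsSq_sum_mul ha
  have s3 := epsSq_sum_e ha c
  have s4 := epsSq_sum_mul_e ha c
  have h12 := sub_ne_zero_of_injective ha (show (1 : Fin 3) ≠ 2 by decide)
  have d1 : (M 1 ^ 2 - m ^ 2 * epsSq a 1 * (z - e a c 1)) +
      (M 2 ^ 2 - m ^ 2 * epsSq a 2 * (z - e a c 2)) = 0 := by
    linear_combination h2 - e0 - m ^ 2 * z * s1 + m ^ 2 * s3
  have d2 : a 1 * (M 1 ^ 2 - m ^ 2 * epsSq a 1 * (z - e a c 1)) +
      a 2 * (M 2 ^ 2 - m ^ 2 * epsSq a 2 * (z - e a c 2)) = 0 := by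
    linear_combination h1 + hl - a 0 * e0 - m ^ 2 * z * s2 + m ^ 2 * s4
  have e1 : M 1 ^ 2 - m ^ 2 * epsSq a 1 * (z - e a c 1) = 0 :=
    (mul_eq_zero.1 (show (a 1 - a 2) * _ = 0 by linear_combination d2 - a 2 * d1)).resolve_left h12
  intro α
  fin_cases α
  · exact e0
  · exact sub_eq_zero.1 e1
  · rw [e1, zero_add] at d1
    exact sub_eq_zero.1 d1

/-- Over `ℂ` this vanishes for `n = k`, where `T` comes from, but for none of the odd `n < k` that
are inverted. -/
theorem det_matA (a : Fin 3 → ℂ) (k n : ℕ) :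
    (matA a k n).det = n * (n ^ 2 - k ^ 2) * vand a := by
  rw [matA, Matrix.det_fin_three, vand]
  simp
  ring

theorem isUnit_det_matA {a : Fin 3 → ℂ} (ha : Function.Injective a) {s j : ℕ} (hj : j < s) :
    IsUnit (matA a (2 * s + 1) (2 * j + 1)).det := by
  rw [isUnit_iff_ne_zero, det_matA]
  refine mul_ne_zero (mul_ne_zero (Nat.cast_ne_zero.2 (by omega)) ?_) (vand_ne_zero ha)
  rw [sub_ne_zero]
  have : (2 * j + 1) ^ 2 < (2 * s + 1) ^ 2 := Nat.pow_lt_pow_left (by omega) two_ne_zero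
  exact_mod_cast this.ne

theorem vand_mul_epsSq {a : Fin 3 → ℂ} (ha : Function.Injective a) :
    vand a * epsSq a 0 = a 2 - a 1 ∧ vand a * epsSq a 1 = a 0 - a 2 ∧
      vand a * epsSq a 2 = a 1 - a 0 := by
  have h01 := sub_ne_zero_of_injective ha (show (0 : Fin 3) ≠ 1 by decide)
  have h12 := sub_ne_zero_of_injective ha (show (1 : Fin 3) ≠ 2 by decide)
  have h02 := sub_ne_zero_of_injective ha (show (0 : Fin 3) ≠ 2 by decide)
  refine ⟨?_, ?_, ?_⟩
  · rw [vand, epsSq_zero]; field_simp; ring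
  · rw [vand, epsSq_one, show a 1 - a 0 = -(a 0 - a 1) by ring]; field_simp; ring
  · rw [vand, epsSq_two, show a 2 - a 1 = -(a 1 - a 2) by ring,
      show a 2 - a 0 = -(a 0 - a 2) by ring]; field_simp; ring

/-- Only the diagonal of `A_n` depends on `n`, and it is proportional to `ε_α²`, as are the
derivatives of the `M_α²` along the Euler flow. The telescoping rests on this coincidence. -/
theorem matA_sub (a : Fin 3 → ℂ) (ha : Function.Injective a) (k n n' : ℕ) :
    matA a k n - matA a k n' =
      (((n' : ℂ) - n) * vand a) • diagonal fun i => epsSq a i := by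
  obtain ⟨v0, v1, v2⟩ := vand_mul_epsSq ha
  ext i j
  fin_cases i <;> fin_cases j <;> simp [matA, mul_assoc, v0, v1, v2] <;> ring

theorem matA_mulVec_one (a : Fin 3 → ℂ) (k : ℕ) : matA a k k *ᵥ 1 = 0 := by
  ext i
  fin_cases i <;> simp [matA, Matrix.mulVec, dotProduct, Fin.sum_univ_three] <;> ring

theorem exists_eq_const_of_ker {a : Fin 3 → ℂ} {k : ℕ} {T : Fin 3 → ℂ}
    (hT : LinearMap.ker (matA a k k).mulVecLin = Submodule.span ℂ {T}) :
    ∃ τ : ℂ, τ ≠ 0 ∧ T = fun _ => τ := by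
  have h1 : (1 : Fin 3 → ℂ) ∈ LinearMap.ker (matA a k k).mulVecLin := by
    rw [LinearMap.mem_ker, Matrix.mulVecLin_apply, matA_mulVec_one]
  rw [hT, Submodule.mem_span_singleton] at h1
  obtain ⟨r, hr⟩ := h1
  have h2 : ∀ α, r * T α = 1 := fun α => by simpa using congrFun hr α
  have hr0 : r ≠ 0 := by rintro rfl; simpa using h2 0
  exact ⟨r⁻¹, inv_ne_zero hr0, funext fun α => eq_inv_of_mul_eq_one_right (h2 α)⟩

theorem mulVec_eq_zero_of_ker {a : Fin 3 → ℂ} {k : ℕ} {T : Fin 3 → ℂ}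
    (hT : LinearMap.ker (matA a k k).mulVecLin = Submodule.span ℂ {T}) : matA a k k *ᵥ T = 0 := by
  have : T ∈ LinearMap.ker (matA a k k).mulVecLin := hT ▸ Submodule.mem_span_singleton_self T
  rwa [LinearMap.mem_ker, Matrix.mulVecLin_apply] at this

/-! ### The vector `Φ_k(M) T` as a polynomial in `z` -/

/-- The product `∏ A_{2j+1}⁻¹ diag(κ)` applied to `T`. -/
noncomputable def phiVec (a : Fin 3 → ℂ) (s : ℕ) (T κ : Fin 3 → ℂ) : Fin 3 → ℂ :=
  ((List.range s).map fun j => (matA a (2 * s + 1) (2 * j + 1))⁻¹ * diagonal κ).prod *ᵥ T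

theorem vecP_eq (a : Fin 3 → ℂ) (s : ℕ) (T M : Fin 3 → ℂ) (α : Fin 3) :
    vecP a s T M α = M α * phiVec a s T (fun i => M i ^ 2) α := by
  rw [vecP, mulVec_diagonal]
  rfl

theorem phiVec_smul (a : Fin 3 → ℂ) (s : ℕ) (T κ : Fin 3 → ℂ) (r : ℂ) :
    phiVec a s T (fun i => r * κ i) = r ^ s • phiVec a s T κ := by
  have h : ∀ l : List ℕ, (l.map fun j => (matA a (2 * s + 1) (2 * j + 1))⁻¹ *
      diagonal fun i => r * κ i).prod = r ^ l.length •
      (l.map fun j => (matA a (2 * s + 1) (2 * j + 1))⁻¹ * diagonal κ).prod := by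
    intro l
    induction l with
    | nil => simp
    | cons j l ih =>
      have hd : (diagonal fun i => r * κ i) = r • diagonal κ := by
        rw [← diagonal_smul]; rfl
      rw [List.map_cons, List.prod_cons, ih, List.map_cons, List.prod_cons, List.length_cons, hd,
        pow_succ, mul_smul_comm, mul_smul_comm, smul_mul_assoc, smul_smul]
  rw [phiVec, h, List.length_range, smul_mulVec, phiVec]

theorem polyF_eval (a : Fin 3 → ℂ) (c : ℂ) (s : ℕ) (T : Fin 3 → ℂ) (α : Fin 3) (x : ℂ) :
    (polyF a c s T α).eval x = phiVec a s T (fun i =>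
      (a (i + 1) - c) * (a (i + 2) - c) / ((a i - a (i + 1)) * (a i - a (i + 2))) * (x - a i)) α := by
  have h1 : (evalRingHom x).mapMatrix ((List.range s).map fun j =>
      ((matA a (2 * s + 1) (2 * j + 1))⁻¹).map (C : ℂ → ℂ[X]) * diagonal fun i : Fin 3 =>
        C ((a (i + 1) - c) * (a (i + 2) - c) / ((a i - a (i + 1)) * (a i - a (i + 2)))) *
          (X - C (a i))).prod = ((List.range s).map fun j =>
      (matA a (2 * s + 1) (2 * j + 1))⁻¹ * diagonal fun i : Fin 3 =>
        (a (i + 1) - c) * (a (i + 2) - c) / ((a i - a (i + 1)) * (a i - a (i + 2))) *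
          (x - a i)).prod := by
    rw [map_list_prod, List.map_map]
    refine congrArg List.prod (List.map_congr_left fun j _ => ?_)
    simp only [Function.comp, map_mul]
    refine congrArg₂ (· * ·) ?_ ?_
    · ext i j
      simp
    · ext i j
      by_cases h : i = j
      · subst h; simp
      · simp [h]
  have h2 : (evalRingHom x : ℂ[X] → ℂ) ∘ (fun i => C (T i)) = T := by
    ext i
    simp
  rw [← coe_evalRingHom, polyF, RingHom.map_mulVec, ← RingHom.mapMatrix_apply, h1, h2, phiVec]

/-- Since `A_k T = 0`, `A_n T = (A_n - A_k) T` is a nonzero multiple of `diag(ε_α²) T`; hence `T` is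
an eigenvector of each factor of the product. -/
theorem phiVec_epsSq {a : Fin 3 → ℂ} (ha : Function.Injective a) {s : ℕ} {T : Fin 3 → ℂ}
    (hT : matA a (2 * s + 1) (2 * s + 1) *ᵥ T = 0) :
    ∃ r : ℂ, r ≠ 0 ∧ phiVec a s T (epsSq a) = r • T := by
  have h : ∀ l : List ℕ, (∀ j ∈ l, j < s) → ∃ r : ℂ, r ≠ 0 ∧
      (l.map fun j => (matA a (2 * s + 1) (2 * j + 1))⁻¹ * diagonal (epsSq a)).prod *ᵥ T =
        r • T := by
    intro l
    induction l with
    | nil => exact fun _ => ⟨1, one_ne_zero, by simp⟩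
    | cons j l ih =>
      intro hl
      obtain ⟨r, hr, hrT⟩ := ih fun i hi => hl i (List.mem_cons_of_mem _ hi)
      have hj : j < s := hl j List.mem_cons_self
      set q : ℂ := (((2 * s + 1 : ℕ) : ℂ) - ((2 * j + 1 : ℕ) : ℂ)) * vand a with hq
      have hq0 : q ≠ 0 := by
        refine mul_ne_zero ?_ (vand_ne_zero ha)
        rw [sub_ne_zero]
        exact_mod_cast (by omega)
      have h1 : matA a (2 * s + 1) (2 * j + 1) *ᵥ T = q • (diagonal (epsSq a) *ᵥ T) := by
        have := matA_sub a ha (2 * s + 1) (2 * j + 1) (2 * s + 1)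
        rw [sub_eq_iff_eq_add] at this
        rw [this, add_mulVec, hT, add_zero, smul_mulVec, hq]
      have h2 : (matA a (2 * s + 1) (2 * j + 1))⁻¹ *ᵥ (diagonal (epsSq a) *ᵥ T) = q⁻¹ • T := by
        have h3 : diagonal (epsSq a) *ᵥ T = q⁻¹ • (matA a (2 * s + 1) (2 * j + 1) *ᵥ T) := by
          rw [h1, smul_smul, inv_mul_cancel₀ hq0, one_smul]
        rw [h3, mulVec_smul, mulVec_mulVec, nonsing_inv_mul _ (isUnit_det_matA ha hj), one_mulVec]
      refine ⟨r * q⁻¹, mul_ne_zero hr (inv_ne_zero hq0), ?_⟩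
      rw [List.map_cons, List.prod_cons, ← mulVec_mulVec, hrT, mulVec_smul, ← mulVec_mulVec, h2,
        smul_smul]
  exact h _ fun j hj => List.mem_range.1 hj

/-- The values of the `F_{s,α}` at `c` do not depend on `α`. -/
theorem exists_polyF_eval_eq {a : Fin 3 → ℂ} (ha : Function.Injective a) {c : ℂ}
    (hca : ∀ α, c ≠ a α) {s : ℕ} {T : Fin 3 → ℂ}
    (hT : LinearMap.ker (matA a (2 * s + 1) (2 * s + 1)).mulVecLin = Submodule.span ℂ {T}) :
    ∃ f₀ : ℂ, f₀ ≠ 0 ∧ ∀ α, (polyF a c s T α).eval c = f₀ := by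
  obtain ⟨τ, hτ, hTτ⟩ := exists_eq_const_of_ker hT
  obtain ⟨r, hr, hrT⟩ := phiVec_epsSq ha (mulVec_eq_zero_of_ker hT)
  -- At `λ = c` the diagonal matrix degenerates to a multiple of `diag(ε_α²)`, so `phiVec_epsSq`
  -- applies, and `T` has equal components.
  have hB : ∀ i : Fin 3, (a (i + 1) - c) * (a (i + 2) - c) / ((a i - a (i + 1)) * (a i - a (i + 2)))
      * (c - a i) = -((a 0 - c) * (a 1 - c) * (a 2 - c)) * epsSq a i := by
    intro i
    rw [epsSq]
    fin_cases i
    · change (a 1 - c) * (a 2 - c) / ((a 0 - a 1) * (a 0 - a 2)) * (c - a 0) =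
        -((a 0 - c) * (a 1 - c) * (a 2 - c)) * (1 / ((a 0 - a 1) * (a 0 - a 2)))
      ring
    · change (a 2 - c) * (a 0 - c) / ((a 1 - a 2) * (a 1 - a 0)) * (c - a 1) =
        -((a 0 - c) * (a 1 - c) * (a 2 - c)) * (1 / ((a 1 - a 2) * (a 1 - a 0)))
      ring
    · change (a 0 - c) * (a 1 - c) / ((a 2 - a 0) * (a 2 - a 1)) * (c - a 2) =
        -((a 0 - c) * (a 1 - c) * (a 2 - c)) * (1 / ((a 2 - a 0) * (a 2 - a 1)))
      ring
  have hB0 : -((a 0 - c) * (a 1 - c) * (a 2 - c)) ≠ 0 :=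
    neg_ne_zero.2 (mul_ne_zero (mul_ne_zero (sub_ne_zero.2 (hca 0).symm)
      (sub_ne_zero.2 (hca 1).symm)) (sub_ne_zero.2 (hca 2).symm))
  refine ⟨(-((a 0 - c) * (a 1 - c) * (a 2 - c))) ^ s * (r * τ),
    mul_ne_zero (pow_ne_zero _ hB0) (mul_ne_zero hr hτ), fun α => ?_⟩
  rw [polyF_eval]
  simp only [hB]
  rw [phiVec_smul, hrT, hTτ]
  simp

/-- The linear factor, normalized at `c`, that belongs to a root on the Riemann sphere. -/
noncomputable def sphereFactor (c x : ℂ) : OnePoint ℂ → ℂ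
  | some q => (x - q) / (c - q)
  | none => 1

theorem sphereRoots_eq (p : ℂ[X]) (s : ℕ) : sphereRoots p s =
    p.roots.map (OnePoint.some : ℂ → OnePoint ℂ) +
      Multiset.replicate (s - p.natDegree) OnePoint.infty := by
  rw [sphereRoots]
  congr 1
  simp [Multiset.bind_def, Multiset.pure_def, Multiset.bind_singleton]

/-- Normalizing the factors at `c` replaces the leading coefficient by the value at `c`, so roots at
infinity can contribute the factor `1`. -/
theorem eval_eq_prod_sphereFactor {p : ℂ[X]} {c : ℂ} (hp : p.eval c ≠ 0) (s : ℕ) (x : ℂ) :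
    p.eval x = p.eval c * ((sphereRoots p s).map (sphereFactor c x)).prod := by
  have h := fun y => (IsAlgClosed.splits p).eval_eq_prod_roots y
  rw [sphereRoots_eq, Multiset.map_add, Multiset.prod_add, Multiset.map_replicate,
    Multiset.prod_replicate, show sphereFactor c x OnePoint.infty = 1 from rfl, one_pow, mul_one,
    Multiset.map_map]
  have h1 : (sphereFactor c x ∘ (OnePoint.some : ℂ → OnePoint ℂ)) = fun q => (x - q) / (c - q) := rfl
  rw [h1, Multiset.prod_map_div, h x]
  rw [h c] at hp ⊢
  have := right_ne_zero_of_mul hp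
  field_simp

theorem ne_of_mem_sphereRoots {p : ℂ[X]} {c : ℂ} (hp : p.eval c ≠ 0) {s : ℕ} {q : OnePoint ℂ}
    (hq : q ∈ sphereRoots p s) : q ≠ (c : OnePoint ℂ) := by
  rintro rfl
  rw [sphereRoots_eq, Multiset.mem_add, Multiset.mem_map] at hq
  rcases hq with ⟨y, hy, hyc⟩ | h
  · rw [OnePoint.coe_injective hyc] at hy
    exact hp (isRoot_of_mem_roots hy)
  · exact OnePoint.coe_ne_infty _ (Multiset.eq_of_mem_replicate h)

/-- A Möbius map turns differences into linear factors, up to a term that depends on `x` only; this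
also covers roots at infinity. -/
theorem wpt_sub_wpt {a : Fin 3 → ℂ} {c x : ℂ} (hx : x ≠ c) {q : OnePoint ℂ}
    (hq : q ≠ (c : OnePoint ℂ)) : wpt a c (x : OnePoint ℂ) - wpt a c q =
      -((a 0 - c) * (a 1 - c) * (a 2 - c)) / (x - c) * sphereFactor c x q := by
  have hxc := sub_ne_zero.2 hx
  induction q using OnePoint.rec with
  | infty =>
    rw [wpt_eq a c x hx, show sphereFactor c x OnePoint.infty = 1 from rfl]
    ring
  | coe q =>
    have hq' : q ≠ c := fun h => hq (by rw [h])
    have hqc := sub_ne_zero.2 hq'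
    rw [wpt_eq a c x hx, wpt_eq a c q hq',
      show sphereFactor c x (q : OnePoint ℂ) = (x - q) / (c - q) from rfl,
      show c - q = -(q - c) by ring]
    field_simp
    ring

theorem continuous_phiVec (a : Fin 3 → ℂ) (s : ℕ) (T : Fin 3 → ℂ) {κ : ℂ → Fin 3 → ℂ}
    (hκ : Continuous κ) : Continuous fun z => phiVec a s T (κ z) := by
  unfold phiVec
  refine Continuous.matrix_mulVec ?_ continuous_const
  exact continuous_list_prod _ fun j _ => continuous_const.mul hκ.matrix_diagonal

/-- Substitution of the squares of the components in `Φ_k(M) T`. -/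
theorem phiVec_eq_prod {a : Fin 3 → ℂ} {c : ℂ}
    (hca : ∀ α, c ≠ a α) {s : ℕ} {T : Fin 3 → ℂ} {f₀ : ℂ} (hf₀ : f₀ ≠ 0) {α : Fin 3}
    (hf : (polyF a c s T α).eval c = f₀) {ρ : Fin s → OnePoint ℂ}
    (hρ : (Finset.univ.val.map ρ) = sphereRoots (polyF a c s T α) s) (m z : ℂ) :
    phiVec a s T (fun i => m ^ 2 * epsSq a i * (z - e a c i)) α =
      (m ^ 2 / -((a 0 - c) * (a 1 - c) * (a 2 - c))) ^ s * f₀ * ∏ r, (z - wpt a c (ρ r)) := by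
  set B : ℂ := -((a 0 - c) * (a 1 - c) * (a 2 - c)) with hB
  have hB0 : B ≠ 0 :=
    neg_ne_zero.2 (mul_ne_zero (mul_ne_zero (sub_ne_zero.2 (hca 0).symm)
      (sub_ne_zero.2 (hca 1).symm)) (sub_ne_zero.2 (hca 2).symm))
  have hf' : (polyF a c s T α).eval c ≠ 0 := hf ▸ hf₀
  have hfin : ∀ x : ℂ, x ≠ c → phiVec a s T
      (fun i => m ^ 2 * epsSq a i * (wpt a c (x : OnePoint ℂ) - e a c i)) α =
      (m ^ 2 / B) ^ s * f₀ * ∏ r, (wpt a c (x : OnePoint ℂ) - wpt a c (ρ r)) := by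
    intro x hx
    have hxc := sub_ne_zero.2 hx
    have h1 : (fun i => m ^ 2 * epsSq a i * (wpt a c (x : OnePoint ℂ) - e a c i)) = fun i =>
        (m ^ 2 / (x - c)) * ((a (i + 1) - c) * (a (i + 2) - c) /
          ((a i - a (i + 1)) * (a i - a (i + 2))) * (x - a i)) := by
      ext i
      rw [wpt_sub_e a c x hx, epsSq]
      ring
    have h2 : ∏ r, (wpt a c (x : OnePoint ℂ) - wpt a c (ρ r)) =
        (B / (x - c)) ^ s * ((sphereRoots (polyF a c s T α) s).map (sphereFactor c x)).prod := by
      rw [← hρ, Multiset.map_map, Finset.prod_congr rfl fun r _ => wpt_sub_wpt hx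
        (ne_of_mem_sphereRoots hf' (s := s) (q := ρ r) ?_), Finset.prod_mul_distrib]
      · simp [Finset.prod, hB]
      · rw [← hρ]
        exact Multiset.mem_map_of_mem _ (Finset.mem_univ r)
    rw [h1, phiVec_smul, Pi.smul_apply, smul_eq_mul, ← polyF_eval, h2,
      eval_eq_prod_sphereFactor hf' s x, hf]
    have : (m ^ 2 / (x - c)) ^ s = (m ^ 2 / B) ^ s * (B / (x - c)) ^ s := by
      rw [← mul_pow]
      congr 1
      field_simp
    rw [this]
    ring
  -- Every `z` except the image of infinity comes from a finite `x ≠ c`; both sides are continuous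
  -- in `z`, so the exception is harmless.
  have hdense : Dense ({wpt a c OnePoint.infty}ᶜ : Set ℂ) := dense_compl_singleton _
  refine congrFun (Continuous.ext_on hdense
    (f := fun z => phiVec a s T (fun i => m ^ 2 * epsSq a i * (z - e a c i)) α)
    (g := fun z => (m ^ 2 / B) ^ s * f₀ * ∏ r, (z - wpt a c (ρ r))) ?_ ?_ ?_) z
  · exact (continuous_apply α).comp (continuous_phiVec a s T (by fun_prop))
  · fun_prop
  · intro z hz
    have hz' : z - wpt a c OnePoint.infty ≠ 0 := sub_ne_zero.2 hz
    have hx : c + B / (z - wpt a c OnePoint.infty) ≠ c := by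
      simp [hB0, hz']
    have h1 : wpt a c ((c + B / (z - wpt a c OnePoint.infty) : ℂ) : OnePoint ℂ) = z := by
      rw [wpt_eq a c _ hx, add_sub_cancel_left]
      rw [show (a 0 - c) * (a 1 - c) * (a 2 - c) = -B by rw [hB, neg_neg]]
      field_simp
      ring
    have := hfin _ hx
    rwa [h1] at this

/-! ### The Poisson equations for `P(M)` -/

/-- `P(M)` solves the generalized Poisson equations if `M` solves the Euler equations. -/
theorem hasDerivAt_vecP {a : Fin 3 → ℂ} (ha : Function.Injective a) {s : ℕ} {T : Fin 3 → ℂ}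
    (hT : matA a (2 * s + 1) (2 * s + 1) *ᵥ T = 0) {M : ℂ → Fin 3 → ℂ} {t : ℂ}
    (hM : HasDerivAt M (M t ⨯₃ (a * M t)) t) :
    HasDerivAt (fun τ => vecP a s T (M τ))
      (((2 * s + 1 : ℕ) : ℂ) • (vecP a s T (M t) ⨯₃ (a * M t))) t := by
  have hM' := hasDerivAt_pi.1 hM
  set μ : ℂ := M t 0 * M t 1 * M t 2 with hμ
  have hsq : ∀ α, HasDerivAt (fun τ => M τ α ^ 2) (2 * μ * (vand a * epsSq a α)) t := by
    intro α
    have h1 := (hM' α).pow 2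
    refine h1.congr_deriv ?_
    obtain ⟨v0, v1, v2⟩ := vand_mul_epsSq ha
    fin_cases α
    · simp [cross_apply, v0]; ring
    · simp [cross_apply, v1]; ring
    · simp [cross_apply, v2]; ring
  -- Let `H_r` be the product of the last `r` factors applied to `T`. Its derivative is `μ H_{r-1}`,
  -- or `0` for `r = 0`. The relation `K H' = A_n H_r` with `n = 2(s - r) + 1` is what the next step
  -- uses; for `r = 0` it says `A_k T = 0`.
  have key : ∀ r ≤ s, ∃ H' : Fin 3 → ℂ,
      (∀ α, HasDerivAt (fun τ => (((List.range r).map fun i =>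
        (matA a (2 * s + 1) (2 * (s - r + i) + 1))⁻¹ * diagonal fun i => M τ i ^ 2).prod *ᵥ T) α)
        (μ * H' α) t) ∧
      (diagonal fun i => M t i ^ 2) *ᵥ H' = matA a (2 * s + 1) (2 * (s - r) + 1) *ᵥ
        (((List.range r).map fun i =>
        (matA a (2 * s + 1) (2 * (s - r + i) + 1))⁻¹ * diagonal fun i => M t i ^ 2).prod *ᵥ T) := by
    intro r
    induction r with
    | zero =>
      intro _
      refine ⟨0, fun α => ?_, ?_⟩
      · simpa using hasDerivAt_const t (T α)
      · simp [hT]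
    | succ r ih =>
      intro hr
      obtain ⟨H', hH', hK⟩ := ih (by omega)
      set H : ℂ → Fin 3 → ℂ := fun τ => ((List.range r).map fun i =>
        (matA a (2 * s + 1) (2 * (s - r + i) + 1))⁻¹ * diagonal fun i => M τ i ^ 2).prod *ᵥ T
        with hH
      set A := matA a (2 * s + 1) (2 * (s - (r + 1)) + 1) with hA
      have hrec : ∀ τ, (((List.range (r + 1)).map fun i =>
          (matA a (2 * s + 1) (2 * (s - (r + 1) + i) + 1))⁻¹ *
            diagonal fun i => M τ i ^ 2).prod *ᵥ T) =
          A⁻¹ *ᵥ ((diagonal fun i => M τ i ^ 2) *ᵥ H τ) := by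
        intro τ
        rw [List.range_succ_eq_map, List.map_cons, List.prod_cons, List.map_map, add_zero,
          ← mulVec_mulVec, ← mulVec_mulVec, hH]
        congr 4
        refine List.map_congr_left fun i _ => ?_
        simp only [Function.comp]
        rw [show s - (r + 1) + i.succ = s - r + i by omega]
      have hu : IsUnit A.det := isUnit_det_matA ha (by omega)
      refine ⟨H t, fun α => ?_, ?_⟩
      · simp only [hrec]
        have h1 : HasDerivAt (fun τ => (A⁻¹ *ᵥ ((diagonal fun i => M τ i ^ 2) *ᵥ H τ)) α)
            (∑ i, A⁻¹ α i * (2 * μ * (vand a * epsSq a i) * H t i + M t i ^ 2 * (μ * H' i))) t := by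
          simp only [mulVec, dotProduct]
          refine HasDerivAt.fun_sum fun i _ => HasDerivAt.const_mul _ ?_
          have := (hsq i).mul (hH' i)
          refine this.congr_of_eventuallyEq (.of_forall fun τ => ?_)
          exact mulVec_diagonal (fun i => M τ i ^ 2) (H τ) i
        convert! h1 using 1
        -- By `A_n = A_{n+2} + 2V diag(ε_α²)`: the first term gives `K H'` by the induction
        -- hypothesis, the second the derivative of `K` divided by `μ`.
        have h2 : A *ᵥ H t = fun i => 2 * (vand a * epsSq a i) * H t i + M t i ^ 2 * H' i := by
          have h3 := matA_sub a ha (2 * s + 1) (2 * (s - (r + 1)) + 1) (2 * (s - r) + 1)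
          rw [sub_eq_iff_eq_add] at h3
          rw [hA, h3, add_mulVec, ← hK, show s - r = s - (r + 1) + 1 by omega]
          ext i
          rw [Pi.add_apply, smul_mulVec, Pi.smul_apply, mulVec_diagonal, mulVec_diagonal,
            smul_eq_mul]
          push_cast
          ring
        have h3 : H t = A⁻¹ *ᵥ (A *ᵥ H t) := by
          rw [mulVec_mulVec, nonsing_inv_mul _ hu, one_mulVec]
        conv_lhs => rw [h3, h2, mulVec, dotProduct, Finset.mul_sum]
        refine Finset.sum_congr rfl fun i _ => ?_
        ring
      · rw [hrec]
        generalize (diagonal fun i => M t i ^ 2) *ᵥ H t = w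
        rw [mulVec_mulVec, mul_nonsing_inv _ hu, one_mulVec]
  obtain ⟨H', hH', hK⟩ := key s le_rfl
  simp only [Nat.sub_self, zero_add] at hH' hK
  set G : ℂ → Fin 3 → ℂ := fun τ => phiVec a s T fun i => M τ i ^ 2 with hG
  have hG' : ∀ α, HasDerivAt (fun τ => G τ α) (μ * H' α) t := hH'
  have hK' : (diagonal fun i => M t i ^ 2) *ᵥ H' = matA a (2 * s + 1) 1 *ᵥ G t := hK
  have hK0 := congrFun hK' 0
  have hK1 := congrFun hK' 1
  have hK2 := congrFun hK' 2
  simp only [mulVec_diagonal] at hK0 hK1 hK2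
  simp only [mulVec, matA, dotProduct, Fin.sum_univ_three, of_apply, cons_val] at hK0 hK1 hK2
  rw [hasDerivAt_pi]
  intro α
  simp only [vecP_eq]
  have h1 := (hM' α).mul (hG' α)
  refine h1.congr_deriv ?_
  have hGt : (phiVec a s T fun i => M t i ^ 2) = G t := rfl
  push_cast at hK0 hK1 hK2
  -- Row `i` of `K H' = A_1 G`, multiplied by the two components of `M` other than the `i`-th, is
  -- the `i`-th Poisson equation.
  fin_cases α
  · simp only [cross_apply, vecP_eq, hGt, Pi.smul_apply, Pi.mul_apply, smul_eq_mul, cons_val,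
      Fin.zero_eta]
    push_cast
    rw [hμ]
    linear_combination M t 1 * M t 2 * hK0
  · simp only [cross_apply, vecP_eq, hGt, Pi.smul_apply, Pi.mul_apply, smul_eq_mul, cons_val,
      Fin.mk_one]
    push_cast
    rw [hμ]
    linear_combination M t 0 * M t 2 * hK1
  · simp only [cross_apply, vecP_eq, hGt, Pi.smul_apply, Pi.mul_apply, smul_eq_mul, cons_val,
      Fin.reduceFinMk]
    push_cast
    rw [hμ]
    linear_combination M t 0 * M t 1 * hK2

/-! ### The signs `ε_α` and the uniformization of the Euler flow -/

theorem IsEps.sq {a ε : Fin 3 → ℂ} (h : IsEps a ε) (α : Fin 3) : ε α ^ 2 = epsSq a α := h.1 α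

theorem IsEps.ne_zero {a ε : Fin 3 → ℂ} (ha : Function.Injective a) (h : IsEps a ε) (α : Fin 3) :
    ε α ≠ 0 := fun h0 => epsSq_ne_zero ha α (by rw [← h.sq, h0, zero_pow two_ne_zero])

/-- The relation on `1 / (ε₁ε₂ε₃)` is needed for this: these are the coefficients that match `ξ_α' =
-ξ_β ξ_γ` with the Euler equations. -/
theorem IsEps.mul_eq {a ε : Fin 3 → ℂ} (ha : Function.Injective a) (h : IsEps a ε) :
    Complex.I * ε 0 = (a 1 - a 2) * (ε 1 * ε 2) ∧ Complex.I * ε 1 = (a 2 - a 0) * (ε 2 * ε 0) ∧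
      Complex.I * ε 2 = (a 0 - a 1) * (ε 0 * ε 1) := by
  have h0 := h.ne_zero ha 0
  have h1 := h.ne_zero ha 1
  have h2 := h.ne_zero ha 2
  have hI : Complex.I ≠ 0 := Complex.I_ne_zero
  obtain ⟨v0, v1, v2⟩ := vand_mul_epsSq ha
  have hp : Complex.I * (vand a * (ε 0 * ε 1 * ε 2)) = 1 := by
    have h3 : 1 / (ε 0 * ε 1 * ε 2) = Complex.I * vand a := h.2
    rw [← mul_assoc, ← h3, one_div_mul_cancel (mul_ne_zero (mul_ne_zero h0 h1) h2)]
  rw [← h.sq] at v0 v1 v2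
  have hI2 := Complex.I_sq
  refine ⟨mul_right_cancel₀ h0 ?_, mul_right_cancel₀ h1 ?_, mul_right_cancel₀ h2 ?_⟩
  · linear_combination (-ε 0 * ε 1 * ε 2) * v0 - (Complex.I * ε 0 ^ 2) * hp +
      (vand a * ε 0 ^ 3 * ε 1 * ε 2) * hI2
  · linear_combination (-ε 0 * ε 1 * ε 2) * v1 - (Complex.I * ε 1 ^ 2) * hp +
      (vand a * ε 1 ^ 3 * ε 0 * ε 2) * hI2
  · linear_combination (-ε 0 * ε 1 * ε 2) * v2 - (Complex.I * ε 2 ^ 2) * hp +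
      (vand a * ε 2 ^ 3 * ε 0 * ε 1) * hI2

theorem exists_isEps {a : Fin 3 → ℂ} (ha : Function.Injective a) : ∃ ε, IsEps a ε := by
  obtain ⟨x, hx⟩ := IsAlgClosed.exists_pow_nat_eq (epsSq a 0) two_pos
  obtain ⟨y, hy⟩ := IsAlgClosed.exists_pow_nat_eq (epsSq a 1) two_pos
  have hx0 : x ≠ 0 := by
    rintro rfl
    exact epsSq_ne_zero ha 0 (by rw [← hx, zero_pow two_ne_zero])
  have hy0 : y ≠ 0 := by
    rintro rfl
    exact epsSq_ne_zero ha 1 (by rw [← hy, zero_pow two_ne_zero])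
  have hv := vand_ne_zero ha
  have hI : Complex.I ≠ 0 := Complex.I_ne_zero
  refine ⟨![x, y, 1 / (Complex.I * vand a * x * y)], fun α => ?_, ?_⟩
  · fin_cases α
    · exact hx
    · exact hy
    · change (1 / (Complex.I * vand a * x * y)) ^ 2 = epsSq a 2
      have h01 := sub_ne_zero_of_injective ha (show (0 : Fin 3) ≠ 1 by decide)
      have h12 := sub_ne_zero_of_injective ha (show (1 : Fin 3) ≠ 2 by decide)
      have h02 := sub_ne_zero_of_injective ha (show (0 : Fin 3) ≠ 2 by decide)
      rw [div_pow, mul_pow, mul_pow, mul_pow, hx, hy, Complex.I_sq, vand, epsSq_zero, epsSq_one,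
        epsSq_two, show a 1 - a 0 = -(a 0 - a 1) by ring, show a 2 - a 0 = -(a 0 - a 2) by ring,
        show a 2 - a 1 = -(a 1 - a 2) by ring]
      field_simp
  · change 1 / (x * y * (1 / (Complex.I * vand a * x * y))) = Complex.I * vand a
    field_simp

/-- The curve of the `M_α(u)`: the half-periods are the preimages of the branch points. -/
structure IsUniformized (L : PeriodPair) (Ω a : Fin 3 → ℂ) (c : ℂ) : Prop where
  half : HalfPeriods L Ω
  weierstrassP_eq : ∀ α, L.weierstrassP (Ω α) = e a c α

section

variable {L : PeriodPair} {Ω a : Fin 3 → ℂ} {c : ℂ}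

theorem IsUniformized.of_isAbelIntegral (ha : Function.Injective a) (hca : ∀ α, c ≠ a α)
    (hg₂ : L.g₂ = -4 * (e a c 0 * e a c 1 + e a c 1 * e a c 2 + e a c 2 * e a c 0))
    (hg₃ : L.g₃ = 4 * (e a c 0 * e a c 1 * e a c 2))
    (hΩ₁ : L.ω₁ = 2 * Ω 0) (hΩ₃ : L.ω₂ = 2 * Ω 2) (hΩsum : Ω 0 + Ω 1 + Ω 2 = 0)
    (hΩ : ∀ α, IsAbelIntegral a c (a α : OnePoint ℂ) (Ω α)) : IsUniformized L Ω a c := by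
  have h := fun α => weierstrassP_of_isAbelIntegral hca L hg₂ hg₃
    (fun h => hca α (OnePoint.coe_injective h).symm) (hΩ α)
  have hw : ∀ α, L.weierstrassP (Ω α) = e a c α := fun α => (h α).2.trans (wpt_branch hca α)
  have h0 : 2 * Ω 0 ∈ L.lattice := hΩ₁ ▸ L.ω₁_mem_lattice
  have h2 : 2 * Ω 2 ∈ L.lattice := hΩ₃ ▸ L.ω₂_mem_lattice
  refine ⟨⟨fun α => (h α).1, fun α => ?_, by rw [← hΩ₁, ← hΩ₃]; rfl, fun α β hab => ?_,
    fun u hu => ?_⟩, hw⟩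
  · fin_cases α
    · exact h0
    · have := L.lattice.neg_mem (L.lattice.add_mem h0 h2)
      rwa [show -(2 * Ω 0 + 2 * Ω 2) = 2 * Ω 1 by linear_combination -2 * hΩsum] at this
    · exact h2
  · rw [hw, hw]
    exact e_injective ha hca hab
  · rw [L.derivWeierstrassP_sq u hu, hg₂, hg₃, hw, hw, hw]
    linear_combination 4 * L.weierstrassP u ^ 2 * e_sum a c

theorem solM_apply (m : ℂ) (ε : Fin 3 → ℂ) (u : ℂ) (α : Fin 3) :
    solM L Ω m ε u α = m * ε α * xi L (Ω α) u := rfl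

variable (hU : IsUniformized L Ω a c) (ha : Function.Injective a)

include hU

theorem solM_sq {ε : Fin 3 → ℂ} (hε : IsEps a ε) (m : ℂ) {u : ℂ} (hu : u ∉ L.lattice)
    (α : Fin 3) :
    solM L Ω m ε u α ^ 2 = m ^ 2 * epsSq a α * (L.weierstrassP u - e a c α) := by
  rw [solM_apply, mul_pow, mul_pow, hε.sq, hU.half.xi_sq α hu, hU.weierstrassP_eq]

include ha

theorem hasDerivAt_solM {ε : Fin 3 → ℂ} (hε : IsEps a ε) {m : ℂ} (hm : m ≠ 0) {u : ℂ}
    (hu : u ∉ L.lattice) : HasDerivAt (solM L Ω m ε)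
      ((Complex.I * m)⁻¹ • (solM L Ω m ε u ⨯₃ (a * solM L Ω m ε u))) u := by
  have hI : Complex.I ≠ 0 := Complex.I_ne_zero
  obtain ⟨r0, r1, r2⟩ := hε.mul_eq ha
  rw [hasDerivAt_pi]
  intro α
  have h1 := (hU.half.hasDerivAt_xi α hu).const_mul (m * ε α)
  refine h1.congr_deriv ?_
  rw [Pi.smul_apply, smul_eq_mul, eq_inv_mul_iff_mul_eq₀ (mul_ne_zero hI hm)]
  fin_cases α
  · simp only [cross_apply, Pi.mul_apply, solM_apply, cons_val, Fin.zero_eta]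
    change Complex.I * m * (m * ε 0 * -(xi L (Ω 1) u * xi L (Ω 2) u)) = _
    linear_combination (-m ^ 2 * xi L (Ω 1) u * xi L (Ω 2) u) * r0
  · simp only [cross_apply, Pi.mul_apply, solM_apply, cons_val, Fin.mk_one]
    change Complex.I * m * (m * ε 1 * -(xi L (Ω 2) u * xi L (Ω 0) u)) = _
    linear_combination (-m ^ 2 * xi L (Ω 2) u * xi L (Ω 0) u) * r1
  · simp only [cross_apply, Pi.mul_apply, solM_apply, cons_val, Fin.reduceFinMk]
    change Complex.I * m * (m * ε 2 * -(xi L (Ω 0) u * xi L (Ω 1) u)) = _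
    linear_combination (-m ^ 2 * xi L (Ω 0) u * xi L (Ω 1) u) * r2

theorem sum_solM_sq {ε : Fin 3 → ℂ} (hε : IsEps a ε) (m : ℂ) {u : ℂ} (hu : u ∉ L.lattice) :
    ∑ α, solM L Ω m ε u α ^ 2 = m ^ 2 := by
  rw [Fin.sum_univ_three, solM_sq hU hε m hu, solM_sq hU hε m hu, solM_sq hU hε m hu]
  linear_combination m ^ 2 * L.weierstrassP u * epsSq_sum ha - m ^ 2 * epsSq_sum_e ha c

/-- The common `z` is a value `℘(u)`, which fixes the squares of the components; their signs are
then adjusted by `exists_xi_eq`. -/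
theorem exists_eq_solM {l m : ℂ} (hm : m ≠ 0) (hc : c = l / m ^ 2) {ε : Fin 3 → ℂ}
    (hε : IsEps a ε) {M : Fin 3 → ℂ} (h1 : M ⬝ᵥ (a * M) = l) (h2 : M ⬝ᵥ M = m ^ 2) :
    ∃ u ∉ L.lattice, M = solM L Ω m ε u := by
  obtain ⟨z, hz⟩ := exists_sq_eq ha hm hc h1 h2
  obtain ⟨u, hu, rfl⟩ := exists_weierstrassP_eq L z
  have hε0 := hε.ne_zero ha
  obtain ⟨v, hv, hv'⟩ := hU.half.exists_xi_eq hu (fun α => M α / (m * ε α)) (fun α => by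
    have hE := epsSq_ne_zero ha α
    rw [hU.weierstrassP_eq, div_pow, hz, mul_pow, hε.sq]
    field_simp)
  refine ⟨v, hv, funext fun α => ?_⟩
  have := hε0 α
  rw [solM_apply, hv']
  field_simp

theorem eq_solM_of_curve {ε : Fin 3 → ℂ} (hε : IsEps a ε) {m : ℂ} (hm : m ≠ 0) {I : Set ℝ}
    (hI : IsOpen I) (hIc : IsPreconnected I) {N : ℝ → Fin 3 → ℂ} {η : ℂ}
    (hN : ∀ r ∈ I, HasDerivAt N (η • (N r ⨯₃ (a * N r))) r) {r₀ : ℝ} (hr₀ : r₀ ∈ I) {d : ℂ}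
    (hd : d ∉ L.lattice) (hNd : N r₀ = solM L Ω m ε d) : ∀ r ∈ I,
      Complex.I * m * (η * (r - r₀)) + d ∉ L.lattice ∧
        N r = solM L Ω m ε (Complex.I * m * (η * (r - r₀)) + d) := by
  have hI0 : Complex.I * m ≠ 0 := mul_ne_zero Complex.I_ne_zero hm
  have hE := epsSq_ne_zero ha 0
  -- `Ψ` recovers `℘` from the first component as a polynomial, hence excludes poles along the
  -- curve.
  refine eq_of_flow L (V := fun N : Fin 3 → ℂ => (Complex.I * m)⁻¹ • (N ⨯₃ (a * N)))
    ?_ (G := solM L Ω m ε) (fun u hu => hasDerivAt_solM hU ha hε hm hu)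
    (Ψ := fun N => N 0 ^ 2 / (m ^ 2 * epsSq a 0) + e a c 0) (by fun_prop) (fun u hu => ?_)
    hI hIc (θ := fun r => Complex.I * m * (η * (r - r₀)) + d) (θ' := fun _ => Complex.I * m * η)
    (fun r _ => ?_) continuousOn_const (fun r hr => ?_) hr₀ (by simpa using hd)
    (by simpa using hNd)
  · refine ContDiff.const_smul _ (contDiff_pi.2 fun i => ?_)
    fin_cases i <;> simp [cross_apply] <;> fun_prop
  · rw [solM_sq hU hε m hu]
    field_simp
    ring
  · have := ((((hasDerivAt_id r).ofReal_comp.sub_const (r₀ : ℂ)).const_mul η).const_mul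
      (Complex.I * m)).add_const d
    simpa [mul_assoc] using! this
  · rw [smul_smul, mul_comm (Complex.I * m), mul_assoc, mul_inv_cancel₀ hI0, mul_one]
    exact hN r hr

/-- Every holomorphic solution of the Euler equations is a time shift of `solM`. -/
theorem exists_eq_solM_of_euler {l m : ℂ} (hm : m ≠ 0) (hc : c = l / m ^ 2) {ε : Fin 3 → ℂ}
    (hε : IsEps a ε) {W : Set ℂ} {M : ℂ → Fin 3 → ℂ} (hW : IsOpen W) (hWc : IsPreconnected W)
    (hM : ∀ t ∈ W, HasDerivAt M (M t ⨯₃ (a * M t)) t ∧ M t ⬝ᵥ (a * M t) = l ∧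
      M t ⬝ᵥ M t = m ^ 2) (b : ℂ) :
    ∃ t₀ : ℂ, ∀ t ∈ W, Complex.I * m * (t - t₀) + b ∉ L.lattice ∧
      M t = solM L Ω m ε (Complex.I * m * (t - t₀) + b) := by
  have hI0 : Complex.I * m ≠ 0 := mul_ne_zero Complex.I_ne_zero hm
  rcases W.eq_empty_or_nonempty with rfl | ⟨t₁, ht₁⟩
  · exact ⟨0, by simp⟩
  obtain ⟨d, hd, hMd⟩ := exists_eq_solM hU ha hm hc hε (hM t₁ ht₁).2.1 (hM t₁ ht₁).2.2
  set t₀ := t₁ - (d - b) / (Complex.I * m) with ht₀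
  have hθ₁ : Complex.I * m * (t₁ - t₀) + b = d := by
    rw [ht₀, sub_sub_cancel, mul_div_cancel₀ _ hI0, sub_add_cancel]
  refine ⟨t₀, ?_⟩
  set S : Set ℂ := {t | t ∈ W ∧ Complex.I * m * (t - t₀) + b ∉ L.lattice ∧
    M t = solM L Ω m ε (Complex.I * m * (t - t₀) + b)} with hS
  -- Inside a ball the solution is followed along segments, which reduces the complex time to a real
  -- one; this makes `S` both open and relatively closed.
  have hball : ∀ x r, Metric.ball x r ⊆ W → ∀ p ∈ Metric.ball x r, p ∈ S →
      Metric.ball x r ⊆ S := by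
    intro x r hxr p hp hpS q hq
    have hcont : Continuous fun τ : ℝ => p + τ * (q - p) := by fun_prop
    have hconv : Convex ℝ {τ : ℝ | p + τ * (q - p) ∈ Metric.ball x r} := by
      have := (convex_ball x r).affine_preimage (AffineMap.lineMap (k := ℝ) p q)
      convert! this using 1
      ext τ
      simp [AffineMap.lineMap_apply, add_comm]
    have hder : ∀ τ ∈ {τ : ℝ | p + τ * (q - p) ∈ Metric.ball x r},
        HasDerivAt (fun τ : ℝ => M (p + τ * (q - p))) ((q - p) •
          (M (p + τ * (q - p)) ⨯₃ (a * M (p + τ * (q - p))))) τ := by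
      intro τ hτ
      have h1 : HasDerivAt (fun τ : ℝ => p + (τ : ℂ) * (q - p)) (q - p) τ := by
        simpa using! ((hasDerivAt_id τ).ofReal_comp.mul_const (q - p)).const_add p
      exact (hM _ (hxr hτ)).1.scomp τ h1
    have := eq_solM_of_curve hU ha hε hm (I := {τ : ℝ | p + τ * (q - p) ∈ Metric.ball x r})
      (Metric.isOpen_ball.preimage hcont) hconv.isPreconnected hder (r₀ := 0)
      (by simpa using hp) hpS.2.1 (by simpa using hpS.2.2) 1 (by simpa using hq)
    rw [show Complex.I * m * ((q - p) * (((1 : ℝ) : ℂ) - ((0 : ℝ) : ℂ))) +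
      (Complex.I * m * (p - t₀) + b) = Complex.I * m * (q - t₀) + b by push_cast; ring,
      show p + ((1 : ℝ) : ℂ) * (q - p) = q by push_cast; ring] at this
    exact ⟨hxr hq, this⟩
  have hSo : IsOpen S := by
    rw [Metric.isOpen_iff]
    intro p hp
    obtain ⟨r, hr, hpr⟩ := Metric.isOpen_iff.1 hW p hp.1
    exact ⟨r, hr, hball p r hpr p (Metric.mem_ball_self hr) hp⟩
  have hSc : closure S ∩ W ⊆ S := by
    rintro x ⟨hx, hxW⟩
    obtain ⟨r, hr, hxr⟩ := Metric.isOpen_iff.1 hW x hxW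
    obtain ⟨p, hpS, hp⟩ := Metric.mem_closure_iff.1 hx r hr
    exact hball x r hxr p (by rwa [Metric.mem_ball, dist_comm]) hpS (Metric.mem_ball_self hr)
  have := hWc.subset_of_closure_inter_subset hSo
    ⟨t₁, ht₁, ht₁, by rwa [hθ₁], by rwa [hθ₁]⟩ hSc
  exact fun t ht => (this ht).2

end

/-! ### The sigma form of `P(M)` -/

/-- The constant `κ` in `P(M(t)) = κ P(u)`; `f₀` is the common value of the `F_{s,α}` at `c`. -/
noncomputable def kappa (a : Fin 3 → ℂ) (c m : ℂ) (s : ℕ) (f₀ : ℂ) : ℂ :=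
  m * (m ^ 2 / ((a 0 - c) * (a 1 - c) * (a 2 - c))) ^ s * f₀

theorem kappa_ne_zero {a : Fin 3 → ℂ} {c m : ℂ} (hca : ∀ α, c ≠ a α) (hm : m ≠ 0) (s : ℕ)
    {f₀ : ℂ} (hf₀ : f₀ ≠ 0) : kappa a c m s f₀ ≠ 0 := by
  refine mul_ne_zero (mul_ne_zero hm (pow_ne_zero _ (div_ne_zero (pow_ne_zero _ hm) ?_))) hf₀
  exact mul_ne_zero (mul_ne_zero (sub_ne_zero.2 (hca 0).symm)
      (sub_ne_zero.2 (hca 1).symm)) (sub_ne_zero.2 (hca 2).symm)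

theorem solP_apply {L : PeriodPair} {Ω : Fin 3 → ℂ} {s : ℕ} {v : Fin s → Fin 3 → ℂ}
    (hv : ∀ r α, v r α ∉ L.lattice) (ε : Fin 3 → ℂ) {u : ℂ} (hu : u ∉ L.lattice) (α : Fin 3) :
    solP L Ω v ε u α = ε α * xi L (Ω α) u *
      ∏ r, (L.weierstrassP (v r α) - L.weierstrassP u) := by
  rw [solP, Finset.prod_congr rfl fun r _ => sigma_mul_sigma L hu (hv r α)]
  rfl

theorem vecP_solM {L : PeriodPair} {Ω a : Fin 3 → ℂ} {c : ℂ} (hU : IsUniformized L Ω a c)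
    (hca : ∀ α, c ≠ a α) {s : ℕ} {T : Fin 3 → ℂ} {f₀ : ℂ}
    (hf₀ : f₀ ≠ 0) (hf : ∀ α, (polyF a c s T α).eval c = f₀) {ρ : Fin s → Fin 3 → OnePoint ℂ}
    (hρ : ∀ α, (Finset.univ.val.map fun r => ρ r α) = sphereRoots (polyF a c s T α) s)
    {v : Fin s → Fin 3 → ℂ} (hv : ∀ r α, v r α ∉ L.lattice)
    (hvρ : ∀ r α, L.weierstrassP (v r α) = wpt a c (ρ r α)) {ε : Fin 3 → ℂ} (hε : IsEps a ε)
    (m : ℂ) {u : ℂ} (hu : u ∉ L.lattice) :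
    vecP a s T (solM L Ω m ε u) = kappa a c m s f₀ • solP L Ω v ε u := by
  ext α
  rw [vecP_eq]
  simp only [solM_sq hU hε m hu]
  rw [phiVec_eq_prod hca hf₀ (hf α) (hρ α), Pi.smul_apply, smul_eq_mul, solP_apply hv ε hu,
    solM_apply, kappa]
  -- The sigma quotients give `℘(v) - ℘(u)`; the resulting `(-1)^s` cancels the sign of `-B` in
  -- `phiVec_eq_prod`.
  have h1 : ∏ r, (L.weierstrassP u - wpt a c (ρ r α)) =
      (-1) ^ s * ∏ r, (L.weierstrassP (v r α) - L.weierstrassP u) := by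
    rw [Finset.prod_congr rfl fun r _ => show L.weierstrassP u - wpt a c (ρ r α) =
      (-1) * (L.weierstrassP (v r α) - L.weierstrassP u) by rw [hvρ]; ring,
      Finset.prod_mul_distrib]
    simp
  have h2 : (m ^ 2 / -((a 0 - c) * (a 1 - c) * (a 2 - c))) ^ s * (-1) ^ s =
      (m ^ 2 / ((a 0 - c) * (a 1 - c) * (a 2 - c))) ^ s := by
    rw [← mul_pow, div_neg, neg_mul_neg, mul_one]
  rw [h1, ← h2]
  ring

/-! ### Real motions -/

/-- A solution of `g' = Z (p + q g²)` with `Z` bounded away from zero blows up. -/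
theorem riccati_blowup_of_pos {g Z : ℝ → ℝ} {δ p q : ℝ} (hδ : 0 < δ) (hp : 0 < p) (hq : 0 < q)
    (hZ : ∀ t, δ ≤ Z t) (hg : ∀ t, HasDerivAt g (Z t * (p + q * g t ^ 2)) t) : False := by
  set η := δ * min p q with hη
  have hη0 : 0 < η := mul_pos hδ (lt_min hp hq)
  -- `arctan g` grows at least at the rate `η`, but over a time `π / η` it cannot grow by `π`.
  have hd : ∀ t, HasDerivAt (fun t => Real.arctan (g t) - η * t)
      (1 / (1 + g t ^ 2) * (Z t * (p + q * g t ^ 2)) - η) t := fun t => by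
    simpa using! (hg t).arctan.sub ((hasDerivAt_id t).const_mul η)
  have hmono : Monotone fun t => Real.arctan (g t) - η * t := by
    refine monotone_of_deriv_nonneg (fun t => (hd t).differentiableAt) fun t => ?_
    rw [(hd t).deriv, sub_nonneg, one_div, inv_mul_eq_div, le_div_iff₀ (by positivity), hη,
      mul_assoc]
    have h1 : min p q * (1 + g t ^ 2) ≤ p + q * g t ^ 2 := by
      rw [mul_add, mul_one]
      exact add_le_add (min_le_left _ _)
        (mul_le_mul_of_nonneg_right (min_le_right _ _) (sq_nonneg _))
    exact mul_le_mul (hZ t) h1 (by positivity) (hδ.le.trans (hZ t))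
  have h := hmono (show (0 : ℝ) ≤ Real.pi / η by positivity)
  simp only [mul_zero, sub_zero, mul_div_cancel₀ _ hη0.ne'] at h
  have h1 := Real.neg_pi_div_two_lt_arctan (g 0)
  have h2 := Real.arctan_lt_pi_div_two (g (Real.pi / η))
  linarith

/-- `Z` has no zeros, so it keeps its sign; the equation is invariant under `(g, Z) ↦ (-g, -Z)`. -/
theorem riccati_blowup {g Z : ℝ → ℝ} {δ p q : ℝ} (hδ : 0 < δ) (hp : 0 < p) (hq : 0 < q)
    (hZc : Continuous Z) (hZ : ∀ t, δ ≤ Z t ^ 2)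
    (hg : ∀ t, HasDerivAt g (Z t * (p + q * g t ^ 2)) t) : False := by
  have hne : ∀ t, Z t ≠ 0 := fun t h0 => by
    have := hZ t
    rw [h0] at this
    linarith
  have hs : 0 < √δ := Real.sqrt_pos.2 hδ
  have habs : ∀ t, √δ ≤ |Z t| := fun t => Real.sqrt_le_sqrt (hZ t) |>.trans_eq (Real.sqrt_sq_eq_abs _)
  have hsign : (∀ t, 0 < Z t) ∨ ∀ t, Z t < 0 := by
    by_contra! h
    obtain ⟨⟨x, hx⟩, y, hy⟩ := h
    obtain ⟨t, ht⟩ := mem_range_of_exists_le_of_exists_ge hZc ⟨x, hx⟩ ⟨y, hy⟩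
    exact hne t ht
  rcases hsign with h | h
  · exact riccati_blowup_of_pos hs hp hq (fun t => by simpa [abs_of_pos (h t)] using habs t) hg
  · refine riccati_blowup_of_pos (g := fun t => -g t) (Z := fun t => -Z t) hs hp hq
      (fun t => by simpa [abs_of_neg (h t)] using habs t) fun t => ?_
    refine (hg t).neg.congr_deriv ?_
    ring

/-- The component of a real rigid body motion along the middle axis vanishes at some time. -/
theorem exists_middle_eq_zero {a : Fin 3 → ℝ} {c m : ℝ} {M : ℝ → Fin 3 → ℝ} (h01 : a 0 < a 1)
    (h12 : a 1 < a 2) (hm : m ≠ 0) (hc : c ≠ a 1)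
    (hM : ∀ t, HasDerivAt M (M t ⨯₃ (a * M t)) t) (h1 : ∀ t, M t ⬝ᵥ (a * M t) = c * m ^ 2)
    (h2 : ∀ t, M t ⬝ᵥ M t = m ^ 2) : ∃ t, M t 1 = 0 := by
  by_contra! hne
  have hm2 : 0 < m ^ 2 := by positivity
  simp only [dotProduct, Fin.sum_univ_three, Pi.mul_apply] at h1 h2
  have hM' := fun t => hasDerivAt_pi.1 (hM t)
  have hcont : ∀ i, Continuous fun t => M t i := fun i =>
    continuous_iff_continuousAt.2 fun t => (hM' t i).continuousAt
  have d0 : ∀ t, HasDerivAt (fun t => M t 0) ((a 2 - a 1) * (M t 1 * M t 2)) t := fun t =>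
    (hM' t 0).congr_deriv (by simp [cross_apply]; ring)
  have d1 : ∀ t, HasDerivAt (fun t => M t 1) ((a 0 - a 2) * (M t 2 * M t 0)) t := fun t =>
    (hM' t 1).congr_deriv (by simp [cross_apply]; ring)
  have d2 : ∀ t, HasDerivAt (fun t => M t 2) ((a 1 - a 0) * (M t 0 * M t 1)) t := fun t =>
    (hM' t 2).congr_deriv (by simp [cross_apply]; ring)
  -- The integrals keep one outer component away from zero, the first for `c < a₂` and the third for
  -- `c > a₂`. The ratio of the other outer component to the middle one would then solve a Riccati
  -- equation for all time.
  rcases lt_or_gt_of_ne hc with hlt | hgt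
  · refine riccati_blowup (g := fun t => M t 2 / M t 1) (Z := fun t => M t 0)
      (δ := (a 1 - c) * m ^ 2 / (a 1 - a 0)) (p := a 1 - a 0) (q := a 2 - a 0)
      (div_pos (mul_pos (by linarith) hm2) (by linarith)) (by linarith) (by linarith) (hcont 0)
      (fun t => ?_) (fun t => ?_)
    · rw [div_le_iff₀ (by linarith)]
      have := mul_nonneg (sub_nonneg.2 h12.le) (sq_nonneg (M t 2))
      have e : M t 0 ^ 2 * (a 1 - a 0) = (a 1 - c) * m ^ 2 + (a 2 - a 1) * M t 2 ^ 2 := by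
        linear_combination a 1 * h2 t - h1 t
      linarith
    · have h0 := hne t
      refine ((d2 t).div (d1 t) h0).congr_deriv ?_
      field_simp
      ring
  · refine riccati_blowup (g := fun t => M t 0 / M t 1) (Z := fun t => M t 2)
      (δ := (c - a 1) * m ^ 2 / (a 2 - a 1)) (p := a 2 - a 1) (q := a 2 - a 0)
      (div_pos (mul_pos (by linarith) hm2) (by linarith)) (by linarith) (by linarith) (hcont 2)
      (fun t => ?_) (fun t => ?_)
    · rw [div_le_iff₀ (by linarith)]
      have := mul_nonneg (sub_nonneg.2 h01.le) (sq_nonneg (M t 0))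
      have e : M t 2 ^ 2 * (a 2 - a 1) = (c - a 1) * m ^ 2 + (a 1 - a 0) * M t 0 ^ 2 := by
        linear_combination h1 t - a 1 * h2 t
      linarith
    · have h0 := hne t
      refine ((d0 t).div (d1 t) h0).congr_deriv ?_
      field_simp
      ring

/-- A real rigid body motion is a real time shift of `solM`, for some choice of the signs. -/
theorem exists_eq_solM_of_real {L : PeriodPair} {Ω a : Fin 3 → ℂ} {c : ℂ}
    (hU : IsUniformized L Ω a c) (ha : Function.Injective a) (hca : ∀ α, c ≠ a α) {l m : ℂ}
    (hm : m ≠ 0) (hc : c = l / m ^ 2) {aR : Fin 3 → ℝ} {mR : ℝ} {M : ℝ → Fin 3 → ℝ}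
    (haR : ∀ α, a α = (aR α : ℂ)) (hmR : m = (mR : ℂ)) (h01 : aR 0 < aR 1) (h12 : aR 1 < aR 2)
    (hM : ∀ t, HasDerivAt M (M t ⨯₃ (aR * M t)) t ∧ ((M t ⬝ᵥ (aR * M t) : ℝ) : ℂ) = l ∧
      M t ⬝ᵥ M t = mR ^ 2) :
    ∃ ε : Fin 3 → ℂ, IsEps a ε ∧ ∃ t₀ : ℝ, ∀ t : ℝ,
      Complex.I * m * (t - t₀) + Ω 1 ∉ L.lattice ∧
      (fun α => (M t α : ℂ)) = solM L Ω m ε (Complex.I * m * (t - t₀) + Ω 1) := by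
  have hmR0 : mR ≠ 0 := fun h => hm (by rw [hmR, h, Complex.ofReal_zero])
  set cR : ℝ := (M 0 ⬝ᵥ (aR * M 0)) / mR ^ 2 with hcR
  have hcc : c = (cR : ℂ) := by
    rw [hc, ← (hM 0).2.1, hmR, hcR]
    push_cast
    rfl
  have hl : l = ((cR * mR ^ 2 : ℝ) : ℂ) := by
    rw [← (hM 0).2.1, hcR, div_mul_cancel₀ _ (pow_ne_zero 2 hmR0)]
  obtain ⟨t₀, ht₀⟩ := exists_middle_eq_zero (c := cR) h01 h12 hmR0
    (fun h => hca 1 (by rw [hcc, h, haR])) (fun t => (hM t).1)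
    (fun t => Complex.ofReal_injective ((hM t).2.1.trans hl)) (fun t => (hM t).2.2)
  set N : ℝ → Fin 3 → ℂ := fun t α => (M t α : ℂ) with hN
  have haR' : a = fun α => (aR α : ℂ) := funext haR
  have hNd : ∀ t, HasDerivAt N (N t ⨯₃ (a * N t)) t := by
    intro t
    rw [hasDerivAt_pi]
    intro α
    have h1 := (hasDerivAt_pi.1 (hM t).1 α).ofReal_comp
    refine h1.congr_deriv ?_
    fin_cases α <;> simp [cross_apply, hN, haR']
  have hN1 : ∀ t, N t ⬝ᵥ (a * N t) = l := by
    intro t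
    rw [← (hM t).2.1, haR']
    simp [dotProduct, hN]
  have hN2 : ∀ t, N t ⬝ᵥ N t = m ^ 2 := by
    intro t
    have := congrArg (fun x : ℝ => (x : ℂ)) (hM t).2.2
    simp only [dotProduct] at this
    push_cast at this
    rw [hmR, ← this]
    simp [dotProduct, hN]
  obtain ⟨ε, hε⟩ := exists_isEps ha
  obtain ⟨d, hd, hNd₀⟩ := exists_eq_solM hU ha hm hc hε (hN1 t₀) (hN2 t₀)
  have hcurve := eq_solM_of_curve hU ha hε hm isOpen_univ isPreconnected_univ (N := N) (η := 1)
    (fun r _ => by simpa using hNd r) (mem_univ t₀) hd hNd₀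
  -- At `t₀` the middle component vanishes, hence so does `ξ_2(d)`, and `d ≡ ±Ω_2`; the two classes
  -- coincide since `2Ω_2` is a period.
  have hw : d - Ω 1 ∈ L.lattice := by
    have h1 : xi L (Ω 1) d = 0 := by
      have := congrFun hNd₀ 1
      rw [solM_apply] at this
      have h0 : N t₀ 1 = 0 := by simp [hN, ht₀]
      rw [h0, eq_comm] at this
      exact (mul_eq_zero.1 this).resolve_left (mul_ne_zero hm (hε.ne_zero ha 1))
    have h2 := hU.half.xi_sq 1 hd
    rw [h1, zero_pow two_ne_zero, eq_comm, sub_eq_zero,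
      weierstrassP_eq_iff L hd (hU.half.notMem 1)] at h2
    rcases h2 with h2 | h2
    · have := L.lattice.sub_mem h2 (hU.half.two_mul_mem 1)
      rwa [show d + Ω 1 - 2 * Ω 1 = d - Ω 1 by ring] at this
    · exact h2
  obtain ⟨σ, hσ, hσp, hσu⟩ := hU.half.exists_xi_add hw
  -- The signs caused by the translation have product `1`, so they can be absorbed into `ε` without
  -- breaking its sign relation.
  refine ⟨fun α => ε α * σ α, ⟨fun α => ?_, ?_⟩, t₀, fun t => ?_⟩
  · rw [mul_pow, hσ, mul_one, hε.1]
  · rw [← hε.2, show ε 0 * σ 0 * (ε 1 * σ 1) * (ε 2 * σ 2) =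
      ε 0 * ε 1 * ε 2 * (σ 0 * σ 1 * σ 2) by ring, hσp, mul_one]
  obtain ⟨h1, h2⟩ := hcurve t (mem_univ t)
  rw [one_mul, show Complex.I * m * ((t : ℂ) - t₀) + d =
    (Complex.I * m * (t - t₀) + Ω 1) + (d - Ω 1) by ring] at h1 h2
  have h3 := mt (add_mem_lattice_iff L hw).2 h1
  refine ⟨h3, h2.trans (funext fun α => ?_)⟩
  rw [solM_apply, solM_apply, hσu _ h3]
  ring

/-! ### The explicit solution, its squares, and the main theorem -/

theorem hasDerivAt_solM_solP {L : PeriodPair} {Ω a : Fin 3 → ℂ} {c : ℂ}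
    (hU : IsUniformized L Ω a c) (ha : Function.Injective a) {m : ℂ} (hm : m ≠ 0) {s : ℕ}
    {T : Fin 3 → ℂ} (hT : matA a (2 * s + 1) (2 * s + 1) *ᵥ T = 0) {v : Fin s → Fin 3 → ℂ}
    {κ : ℂ} (hκ : κ ≠ 0) {ε : Fin 3 → ℂ} (hε : IsEps a ε)
    (hvec : ∀ u ∉ L.lattice, vecP a s T (solM L Ω m ε u) = κ • solP L Ω v ε u) {t₀ t b : ℂ}
    (h : Complex.I * m * (t - t₀) + b ∉ L.lattice) :
    HasDerivAt (fun τ : ℂ => solM L Ω m ε (Complex.I * m * (τ - t₀) + b))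
      (solM L Ω m ε (Complex.I * m * (t - t₀) + b) ⨯₃
        (a * solM L Ω m ε (Complex.I * m * (t - t₀) + b))) t ∧
    HasDerivAt (fun τ : ℂ => solP L Ω v ε (Complex.I * m * (τ - t₀) + b))
      (((2 * s + 1 : ℕ) : ℂ) • (solP L Ω v ε (Complex.I * m * (t - t₀) + b) ⨯₃
        (a * solM L Ω m ε (Complex.I * m * (t - t₀) + b)))) t := by
  have hI0 : Complex.I * m ≠ 0 := mul_ne_zero Complex.I_ne_zero hm
  have hθ : HasDerivAt (fun τ : ℂ => Complex.I * m * (τ - t₀) + b) (Complex.I * m) t := by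
    simpa using! (((hasDerivAt_id t).sub_const t₀).const_mul (Complex.I * m)).add_const b
  have h1 : HasDerivAt (fun τ : ℂ => solM L Ω m ε (Complex.I * m * (τ - t₀) + b))
      (solM L Ω m ε (Complex.I * m * (t - t₀) + b) ⨯₃
        (a * solM L Ω m ε (Complex.I * m * (t - t₀) + b))) t := by
    have := (hasDerivAt_solM hU ha hε hm h).scomp t hθ
    rwa [smul_smul, mul_inv_cancel₀ hI0, one_smul] at this
  refine ⟨h1, ?_⟩
  have h2 := (hasDerivAt_vecP ha hT h1).const_smul κ⁻¹
  have hev : (fun τ : ℂ => solP L Ω v ε (Complex.I * m * (τ - t₀) + b)) =ᶠ[𝓝 t]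
      κ⁻¹ • fun τ : ℂ => vecP a s T (solM L Ω m ε (Complex.I * m * (τ - t₀) + b)) := by
    filter_upwards [hθ.continuousAt.eventually ((isOpen_compl_lattice L).mem_nhds h)] with τ hτ
    rw [Pi.smul_apply, hvec _ hτ, smul_smul, inv_mul_cancel₀ hκ, one_smul]
  refine (h2.congr_of_eventuallyEq hev).congr_deriv ?_
  rw [hvec _ h, map_smul, LinearMap.smul_apply, smul_comm, smul_smul κ⁻¹, inv_mul_cancel₀ hκ,
    one_smul]

theorem solP_sq {L : PeriodPair} {Ω : Fin 3 → ℂ} (hΩ : HalfPeriods L Ω) {s : ℕ}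
    {v : Fin s → Fin 3 → ℂ} (hv : ∀ r α, v r α ∉ L.lattice) (ε : Fin 3 → ℂ) {u : ℂ}
    (hu : u ∉ L.lattice) (α : Fin 3) :
    solP L Ω v ε u α ^ 2 = ε α ^ 2 * (L.weierstrassP u - L.weierstrassP (Ω α)) *
      ∏ r, (L.weierstrassP u - L.weierstrassP (v r α)) ^ 2 := by
  rw [solP_apply hv ε hu, mul_pow, mul_pow, hΩ.xi_sq α hu, ← Finset.prod_pow]
  congr 1
  exact Finset.prod_congr rfl fun r _ => by ring

theorem sum_solP_sq {L : PeriodPair} {Ω a : Fin 3 → ℂ} (hΩ : HalfPeriods L Ω) {s : ℕ}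
    {v : Fin s → Fin 3 → ℂ} (hv : ∀ r α, v r α ∉ L.lattice) {ε : Fin 3 → ℂ} {μ b q t₀ : ℂ}
    (hμ : μ ≠ 0) {N : ℂ → Fin 3 → ℂ}
    (hP : ∀ t, μ * (t - t₀) + b ∉ L.lattice →
      HasDerivAt (fun τ => solP L Ω v ε (μ * (τ - t₀) + b))
        (q • (solP L Ω v ε (μ * (t - t₀) + b) ⨯₃ (a * N t))) t)
    {u : ℂ} (hu : u ∉ L.lattice) {α β γ : Fin 3} (hab : α ≠ β) (hbc : β ≠ γ) (hca : γ ≠ α) :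
    ∑ δ, solP L Ω v ε u δ ^ 2 = PiConst L Ω v ε α β γ := by
  -- `γ × aM` is orthogonal to `γ`; time is rewritten as an affine function of `u`.
  have hder : ∀ u ∉ L.lattice, HasDerivAt (fun u => ∑ δ, solP L Ω v ε u δ ^ 2) 0 u := by
    intro u hu
    set t := t₀ + (u - b) / μ with ht
    have hθ : ∀ z : ℂ, μ * (t₀ + (z - b) / μ - t₀) + b = z := fun z => by field_simp; ring
    have h1 := hasDerivAt_pi.1 (hP t (by rw [ht, hθ]; exact hu))
    have h2 : HasDerivAt (fun τ => ∑ δ, solP L Ω v ε (μ * (τ - t₀) + b) δ ^ 2) 0 t := by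
      have := HasDerivAt.fun_sum (u := Finset.univ) fun δ _ => (h1 δ).pow 2
      refine this.congr_deriv ?_
      simp only [Fin.sum_univ_three, cross_apply, Pi.smul_apply, Pi.mul_apply, smul_eq_mul,
        cons_val]
      ring
    have h3 : HasDerivAt (fun z : ℂ => t₀ + (z - b) / μ) (1 / μ) u :=
      (((hasDerivAt_id u).sub_const b).div_const μ).const_add t₀
    have h4 := HasDerivAt.comp u (h := fun z : ℂ => t₀ + (z - b) / μ) h2 h3
    rw [zero_mul] at h4
    simpa only [Function.comp_def, hθ] using h4
  obtain ⟨C, hC⟩ := (isOpen_compl_lattice L).exists_is_const_of_deriv_eq_zero (𝕜 := ℂ)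
    (isPreconnected_compl_lattice L)
    (fun u hu => (hder u hu).differentiableAt.differentiableWithinAt)
    (fun u hu => (hder u hu).deriv)
  -- The constant is evaluated at `Ω_α`, where the `α`-th square vanishes.
  rw [hC u hu, ← hC (Ω α) (hΩ.notMem α), PiConst]
  have huniv : (Finset.univ : Finset (Fin 3)) = {α, β, γ} := by
    revert α β γ
    decide
  rw [huniv, Finset.sum_insert (by simp [hab, hca.symm]), Finset.sum_pair hbc,
    solP_sq hΩ hv ε (hΩ.notMem α), solP_sq hΩ hv ε (hΩ.notMem α),
    solP_sq hΩ hv ε (hΩ.notMem α), sub_self]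
  ring

end EulerPoisson

theorem mainTheorem6
    (k s : ℕ) (hk : k = 2 * s + 1)
    (a : Fin 3 → ℂ) (ha : Function.Injective a)
    (l m c : ℂ) (hm : m ≠ 0) (hc : c = l / m ^ 2) (hca : ∀ α, c ≠ a α)
    -- the vector `T` spans the kernel of `A_k`
    (T : Fin 3 → ℂ)
    (hT : LinearMap.ker (EulerPoisson.matA a k k).mulVecLin = Submodule.span ℂ {T})
    -- the lattice of the curve, with the half-periods `Ω_α`
    (L : PeriodPair)
    (hg₂ : L.g₂ = -4 * (EulerPoisson.e a c 0 * EulerPoisson.e a c 1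
      + EulerPoisson.e a c 1 * EulerPoisson.e a c 2
      + EulerPoisson.e a c 2 * EulerPoisson.e a c 0))
    (hg₃ : L.g₃ = 4 * (EulerPoisson.e a c 0 * EulerPoisson.e a c 1 * EulerPoisson.e a c 2))
    (Ω : Fin 3 → ℂ) (hΩ₁ : L.ω₁ = 2 * Ω 0) (hΩ₃ : L.ω₂ = 2 * Ω 2)
    (hΩsum : Ω 0 + Ω 1 + Ω 2 = 0)
    (hΩ : ∀ α, EulerPoisson.IsAbelIntegral a c (a α : OnePoint ℂ) (Ω α))
    -- the roots of `F_{s,α}` and their Abel images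
    (ρ : Fin s → Fin 3 → OnePoint ℂ)
    (hρ : ∀ α, (Finset.univ.val.map fun r => ρ r α) =
      EulerPoisson.sphereRoots (EulerPoisson.polyF a c s T α) s)
    (v : Fin s → Fin 3 → ℂ)
    (hv : ∀ r α, EulerPoisson.IsAbelIntegral a c (ρ r α) (v r α)) :
    (∀ r α, v r α ∉ L.lattice) ∧
    ∃ κ : ℂ, κ ≠ 0 ∧
      (∀ ε : Fin 3 → ℂ, EulerPoisson.IsEps a ε →
        -- the explicit vectors solve the Euler and the Poisson equations
        (∀ t₀ t : ℂ, Complex.I * m * (t - t₀) + Ω 1 ∉ L.lattice →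
          HasDerivAt
            (fun τ : ℂ => EulerPoisson.solM L Ω m ε (Complex.I * m * (τ - t₀) + Ω 1))
            (EulerPoisson.solM L Ω m ε (Complex.I * m * (t - t₀) + Ω 1) ⨯₃
              (a * EulerPoisson.solM L Ω m ε (Complex.I * m * (t - t₀) + Ω 1))) t ∧
          HasDerivAt
            (fun τ : ℂ => EulerPoisson.solP L Ω v ε (Complex.I * m * (τ - t₀) + Ω 1))
            ((k : ℂ) • (EulerPoisson.solP L Ω v ε (Complex.I * m * (t - t₀) + Ω 1) ⨯₃
              (a * EulerPoisson.solM L Ω m ε (Complex.I * m * (t - t₀) + Ω 1)))) t) ∧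
        -- every solution `M` of the Euler equations, and `P(M)`, are of this form
        (∀ (W : Set ℂ) (M : ℂ → Fin 3 → ℂ), IsOpen W → IsPreconnected W →
          (∀ t ∈ W, HasDerivAt M (M t ⨯₃ (a * M t)) t ∧
            M t ⬝ᵥ (a * M t) = l ∧ M t ⬝ᵥ M t = m ^ 2) →
          ∃ t₀ : ℂ, ∀ t ∈ W,
            Complex.I * m * (t - t₀) + Ω 1 ∉ L.lattice ∧
            M t = EulerPoisson.solM L Ω m ε (Complex.I * m * (t - t₀) + Ω 1) ∧
            EulerPoisson.vecP a s T (M t) =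
              κ • EulerPoisson.solP L Ω v ε (Complex.I * m * (t - t₀) + Ω 1)) ∧
        -- squares of the components, and the two constant sums of squares
        (∀ u : ℂ, u ∉ L.lattice →
          (∀ α, EulerPoisson.solP L Ω v ε u α ^ 2 =
            ε α ^ 2 * (L.weierstrassP u - L.weierstrassP (Ω α)) *
              ∏ r, (L.weierstrassP u - L.weierstrassP (v r α)) ^ 2) ∧
          ∑ α, EulerPoisson.solM L Ω m ε u α ^ 2 = m ^ 2 ∧
          ∀ α β γ : Fin 3, α ≠ β → β ≠ γ → γ ≠ α →
            ∑ δ, EulerPoisson.solP L Ω v ε u δ ^ 2 =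
              EulerPoisson.PiConst L Ω v ε α β γ)) ∧
      -- real motions: `t₀` can be taken real, for a suitable choice of the signs
      (∀ (aR : Fin 3 → ℝ) (mR : ℝ) (M : ℝ → Fin 3 → ℝ),
        (∀ α, a α = (aR α : ℂ)) → m = (mR : ℂ) → aR 0 < aR 1 → aR 1 < aR 2 →
        (∀ t, HasDerivAt M (M t ⨯₃ (aR * M t)) t ∧
          ((M t ⬝ᵥ (aR * M t) : ℝ) : ℂ) = l ∧ M t ⬝ᵥ M t = mR ^ 2) →
        ∃ ε : Fin 3 → ℂ, EulerPoisson.IsEps a ε ∧ ∃ t₀ : ℝ, ∀ t : ℝ,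
          Complex.I * m * (t - t₀) + Ω 1 ∉ L.lattice ∧
          (fun α => (M t α : ℂ)) =
            EulerPoisson.solM L Ω m ε (Complex.I * m * (t - t₀) + Ω 1) ∧
          EulerPoisson.vecP a s T (fun α => (M t α : ℂ)) =
            κ • EulerPoisson.solP L Ω v ε (Complex.I * m * (t - t₀) + Ω 1)) := by
  subst hk
  have hU := EulerPoisson.IsUniformized.of_isAbelIntegral ha hca hg₂ hg₃ hΩ₁ hΩ₃ hΩsum hΩ
  obtain ⟨f₀, hf₀, hf⟩ := EulerPoisson.exists_polyF_eval_eq ha hca hT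
  have hT0 := EulerPoisson.mulVec_eq_zero_of_ker hT
  have hvρ : ∀ r α, v r α ∉ L.lattice ∧ L.weierstrassP (v r α) = EulerPoisson.wpt a c (ρ r α) := by
    intro r α
    refine EulerPoisson.weierstrassP_of_isAbelIntegral hca L hg₂ hg₃ ?_ (hv r α)
    -- A root at `c` would allow an Abel integral that is a period; it is excluded by `F_{s,α}(c) =
    -- f₀ ≠ 0`.
    refine EulerPoisson.ne_of_mem_sphereRoots (p := EulerPoisson.polyF a c s T α) (s := s)
      (by rw [hf]; exact hf₀) ?_
    rw [← hρ]
    exact Multiset.mem_map_of_mem _ (Finset.mem_univ r)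
  have hv0 := fun r α => (hvρ r α).1
  set κ := EulerPoisson.kappa a c m s f₀ with hκ
  have hκ0 : κ ≠ 0 := EulerPoisson.kappa_ne_zero hca hm s hf₀
  have hI0 : Complex.I * m ≠ 0 := mul_ne_zero Complex.I_ne_zero hm
  have hvec : ∀ ε, EulerPoisson.IsEps a ε → ∀ u ∉ L.lattice,
      EulerPoisson.vecP a s T (EulerPoisson.solM L Ω m ε u) = κ • EulerPoisson.solP L Ω v ε u :=
    fun ε hε u hu => EulerPoisson.vecP_solM hU hca hf₀ hf hρ hv0 (fun r α => (hvρ r α).2) hε m hu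
  refine ⟨hv0, κ, hκ0, fun ε hε => ?_, ?_⟩
  · have hpart1 : ∀ t₀ t : ℂ, Complex.I * m * (t - t₀) + Ω 1 ∉ L.lattice →
          HasDerivAt
            (fun τ : ℂ => EulerPoisson.solM L Ω m ε (Complex.I * m * (τ - t₀) + Ω 1))
            (EulerPoisson.solM L Ω m ε (Complex.I * m * (t - t₀) + Ω 1) ⨯₃
              (a * EulerPoisson.solM L Ω m ε (Complex.I * m * (t - t₀) + Ω 1))) t ∧
          HasDerivAt
            (fun τ : ℂ => EulerPoisson.solP L Ω v ε (Complex.I * m * (τ - t₀) + Ω 1))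
            (((2 * s + 1 : ℕ) : ℂ) •
              (EulerPoisson.solP L Ω v ε (Complex.I * m * (t - t₀) + Ω 1) ⨯₃
              (a * EulerPoisson.solM L Ω m ε (Complex.I * m * (t - t₀) + Ω 1)))) t :=
      fun t₀ t h => EulerPoisson.hasDerivAt_solM_solP hU ha hm hT0 hκ0 hε (hvec ε hε) h
    refine ⟨hpart1, fun W M hW hWc hM => ?_, fun u hu => ⟨fun α => ?_,
      EulerPoisson.sum_solM_sq hU ha hε m hu, fun α β γ hab hbc hca' => ?_⟩⟩
    · obtain ⟨t₀, ht₀⟩ := EulerPoisson.exists_eq_solM_of_euler hU ha hm hc hε hW hWc hM (Ω 1)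
      exact ⟨t₀, fun t ht => ⟨(ht₀ t ht).1, (ht₀ t ht).2, by
        rw [(ht₀ t ht).2, hvec ε hε _ (ht₀ t ht).1]⟩⟩
    · exact EulerPoisson.solP_sq hU.half hv0 ε hu α
    · exact EulerPoisson.sum_solP_sq hU.half hv0 hI0 (fun t h => (hpart1 0 t h).2) hu hab hbc hca'
  · intro aR mR M haR hmR h01 h12 hM
    obtain ⟨ε, hε, t₀, ht₀⟩ :=
      EulerPoisson.exists_eq_solM_of_real hU ha hca hm hc haR hmR h01 h12 hM
    exact ⟨ε, hε, t₀, fun t => ⟨(ht₀ t).1, (ht₀ t).2, by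
      rw [(ht₀ t).2, hvec ε hε _ (ht₀ t).1]⟩⟩
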